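/- For a bounded interval $(a,b)$, a function $u:(a,b)\to\mathbb{R}$ is called a pure jump function if there are $c\in\mathbb{R}$, an at most countable set $S_u\subseteq(a,b)$ and $J:S_u\to\mathbb{R}\setminus\{0\}$ with $\sum_{y\in S_u}|J(y)|<+\infty$ such that $u(x)=c+\sum_{y\in S_u,\,y\le x}J(y)$ for every $x\in(a,b)$. Let $PJ_{\mathrm{loc}}(\mathbb{R})$ be the set of functions $u:\mathbb{R}\to\mathbb{R}$ whose restriction to every bounded open interval is a pure jump function. For $u\in PJ_{\mathrm{loc}}(\mathbb{R})$ let $S_u$ be the set of its discontinuity points, and let $|u^+(x)-u^-(x)|$ be the absolute difference of its right and left limits at $x\in S_u$. Let $\theta\in[0,1)$, $\alpha>0$, $\beta>0$, $M\neq 0$ be real numbers, and for every open set $\Omega\subseteq\mathbb{R}$ and every $u\in PJ_{\mathrm{loc}}(\mathbb{R})$ set $$\mathbb{JF}(\Omega,u):=\alpha\sum_{x\in S_u\cap\Omega}|u^+(x)-u^-(x)|^\theta+\beta\int_\Omega(u(x)-Mx)^2\,dx\in[0,+\infty].$$ An entire local minimizer of $\mathbb{JF}$ is a function $u\in PJ_{\mathrm{loc}}(\mathbb{R})$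 such that $\mathbb{JF}(\Omega,u)<+\infty$ for every bounded open set $\Omega\subseteq\mathbb{R}$, and $\mathbb{JF}(\Omega,u)\le\mathbb{JF}(\Omega,v)$ for every open set $\Omega\subseteq\mathbb{R}$ and every $v\in PJ_{\mathrm{loc}}(\mathbb{R})$ that coincides with $u$ outside a compact subset of $\Omega$. Let $S(x):=2\lfloor (x+1)/2\rfloor$. For $H>0$ and $V\in\mathbb{R}$, the canonical $(H,V)$-staircase is $S_{H,V}(x):=V\cdot S(x/H)$, and its oblique translations are the functions $x\mapsto S_{H,V}(x-H\tau_0)+V\tau_0$ with $\tau_0\in[-1,1]$. Theorem. Let $$H:=\left(\frac{3(1-\theta)\alpha}{(2|M|)^{2-\theta}\beta}\right)^{1/(3-\theta)},\qquad V:=MH.$$ Then the set of entire local minimizers of $\mathbb{JF}$ coincides with the set of all oblique translations of the canonical $(H,V)$-staircase. -/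

import Mathlib

open Set MeasureTheory

noncomputable section

namespace JumpFunctional

/-- `u` is a pure jump function on the interval `(a, b)`: a constant plus an absolutely summable
series of jumps `J y ≠ 0` located at the points `y` of an at most countable set `S ⊆ (a, b)`. -/
def IsPureJumpOn (a b : ℝ) (u : ℝ → ℝ) : Prop :=
  ∃ (c : ℝ) (S : Set ℝ) (J : ℝ → ℝ),
    S ⊆ Ioo a b ∧ S.Countable ∧ (∀ y ∈ S, J y ≠ 0) ∧
    Summable (fun y : S => |J y|) ∧
    ∀ x ∈ Ioo a b, u x = c + ∑' y : {y : ℝ // y ∈ S ∧ y ≤ x}, J y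

/-- Locally pure jump functions on the line: the restriction to every bounded open interval is a
pure jump function. -/
def PJloc (u : ℝ → ℝ) : Prop :=
  ∀ a b : ℝ, a < b → IsPureJumpOn a b u

/-- The set of jump points, i.e. of discontinuity points, of `u`. -/
def jumpSet (u : ℝ → ℝ) : Set ℝ := {x | ¬ ContinuousAt u x}

/-- The jump height of `u` at `x`: the distance between the right and the left limit
(both limits exist at every point when `u` is a locally pure jump function). -/
def jumpHeight (u : ℝ → ℝ) (x : ℝ) : ℝ :=
  |Function.rightLim u x - Function.leftLim u x|

/-- The jump functional with fidelity term, with values in `[0, ∞]`. -/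
def JF (θ α β M : ℝ) (Ω : Set ℝ) (u : ℝ → ℝ) : ENNReal :=
  ENNReal.ofReal α * (∑' x : (jumpSet u ∩ Ω : Set ℝ), ENNReal.ofReal (jumpHeight u x ^ θ)) +
    ENNReal.ofReal β * ∫⁻ x in Ω, ENNReal.ofReal ((u x - M * x) ^ 2)

/-- Entire local minimizers: locally pure jump functions, of finite energy on bounded open sets,
that minimize the functional on every open set `Ω` among all locally pure jump functions which
coincide with them outside a compact subset of `Ω`. Finiteness has to be required: if the energy
of `u` is infinite on every nonempty open set, then so is that of every such competitor. -/
def IsEntireLocalMinimizer (θ α β M : ℝ) (u : ℝ → ℝ) : Prop :=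
  PJloc u ∧
  (∀ Ω : Set ℝ, IsOpen Ω → Bornology.IsBounded Ω → JF θ α β M Ω u < ⊤) ∧
  ∀ Ω : Set ℝ, IsOpen Ω → ∀ v : ℝ → ℝ, PJloc v →
    (∃ K : Set ℝ, IsCompact K ∧ K ⊆ Ω ∧ ∀ x, x ∉ K → v x = u x) →
    JF θ α β M Ω u ≤ JF θ α β M Ω v

/-- The basic staircase `S(x) = 2 ⌊(x + 1) / 2⌋`. -/
def basicStaircase (x : ℝ) : ℝ := 2 * (⌊(x + 1) / 2⌋ : ℝ)

/-- The canonical `(H, V)`-staircase `x ↦ V * S(x / H)`. -/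
def staircase (H V x : ℝ) : ℝ := V * basicStaircase (x / H)

/-- `v` is an oblique translation of the canonical `(H, V)`-staircase. -/
def IsObliqueTranslation (H V : ℝ) (v : ℝ → ℝ) : Prop :=
  ∃ τ ∈ Icc (-1 : ℝ) 1, ∀ x, v x = staircase H V (x - H * τ) + V * τ

end JumpFunctional

end

/-! Dividing `u` by `M` reduces to slope one (`isEntireLocalMinimizer_iff_normalized`). Write `w = u
x - x`: it decreases at unit speed between jumps. A step of length and height `d`, with `w` falling
from `d / 2` to `-d / 2`, costs `α * d ^ θ + β * d ^ 3 / 12`. Per unit length this is least exactly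
at `d = 2 * H`, where it equals `rate`.

Staircases minimize by calibration. If `Ψ' ≤ β * w ^ 2 - rate` and `Ψ p - Ψ q` never exceeds the
cost of a jump from `p` to `q`, the chain rule bounds the energy on `(a, b]` below by `rate * (b -
a)` plus the drop of `Ψ` between the endpoints (`HasJumps.le_energy`). The potential with derivative
`min 0 (β * w ^ 2 - rate)` qualifies (`potential_drop`), and equality holds along optimal staircases
(`energy_steps_eq`). A competitor has the same boundary values, so it cannot cost less.

Conversely, let `u` be a minimizer. It comes back to `|w| < H` arbitrarily far to the left and to
the right (`exists_le_abs_lt`, `exists_ge_abs_lt`). Between two such points it is compared with a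
staircase of `N` equal steps that meets it at both ends. The step length differs from `2 * H` by
`O(1 / N)`, and the excess per step vanishes to first order at `2 * H`, so the total excess tends to
zero. As the lower bound is additive in the interval, equality holds on every interval
(`energy_eq`). Equality keeps `w` within the cutoff (`abs_le_cutoff`) and makes every jump go from
`-H` to `H` (`jump_eq`), which forces a staircase (`eq_steps`). -/

open Filter Topology

/-! ### Jump functions through their increments: one-sided limits, uniqueness of jumps, gluing. -/

namespace JumpFunctional

/-- `u` is right-continuous and its increments are the sums of the locally summable jumps `J`. -/
structure HasJumps (u J : ℝ → ℝ) : Prop where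
  summable : ∀ a b, Summable ((Ioc a b).indicator J)
  sub_eq : ∀ a b, a ≤ b → u b - u a = ∑' t, (Ioc a b).indicator J t

namespace HasJumps

variable {u s J K : ℝ → ℝ}

theorem tendsto_right (h : HasJumps u J) (x : ℝ) : Tendsto u (𝓝[>] x) (𝓝 (u x)) := by
  have key : Tendsto (fun z => ∑' t, (Ioc x z).indicator J t) (𝓝[>] x)
      (𝓝 (∑' _ : ℝ, (0 : ℝ))) := by
    refine tendsto_tsum_of_dominated_convergence
      (bound := fun t => |(Ioc x (x + 1)).indicator J t|) (h.summable _ _).abs ?_ ?_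
    · intro t
      refine tendsto_const_nhds.congr' ?_
      rcases le_or_gt t x with ht | ht
      · filter_upwards with z
        rw [indicator_of_notMem (fun hm => absurd hm.1 (not_lt.2 ht))]
      · filter_upwards [Ioo_mem_nhdsGT ht] with z hz
        rw [indicator_of_notMem (fun hm => absurd hm.2 (not_le.2 hz.2))]
    · filter_upwards [Ioo_mem_nhdsGT (lt_add_one x)] with z hz t
      by_cases ht : t ∈ Ioc x z
      · rw [indicator_of_mem ht, indicator_of_mem
          (show t ∈ Ioc x (x + 1) from ⟨ht.1, ht.2.trans hz.2.le⟩),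
          Real.norm_eq_abs]
      · rw [indicator_of_notMem ht]; simp
  rw [tsum_zero] at key
  have := key.const_add (u x)
  rw [add_zero] at this
  refine this.congr' ?_
  filter_upwards [self_mem_nhdsWithin] with z hz
  rw [← h.sub_eq x z (le_of_lt hz)]; ring

theorem tendsto_left (h : HasJumps u J) (x : ℝ) : Tendsto u (𝓝[<] x) (𝓝 (u x - J x)) := by
  have key : Tendsto (fun z => ∑' t, (Ioc z x).indicator J t) (𝓝[<] x)
      (𝓝 (∑' t : ℝ, ({x} : Set ℝ).indicator J t)) := by
    refine tendsto_tsum_of_dominated_convergence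
      (bound := fun t => |(Ioc (x - 1) x).indicator J t|) (h.summable _ _).abs ?_ ?_
    · intro t
      refine tendsto_const_nhds.congr' ?_
      rcases lt_trichotomy t x with ht | ht | ht
      · filter_upwards [Ioo_mem_nhdsLT ht] with z hz
        rw [indicator_of_notMem (by simpa using ht.ne),
          indicator_of_notMem (fun hm => absurd hm.1 (not_lt.2 hz.1.le))]
      · filter_upwards [self_mem_nhdsWithin] with z hz
        subst ht
        rw [indicator_of_mem (mem_singleton t), indicator_of_mem (show t ∈ Ioc z t from ⟨hz, le_rfl⟩)]
      · filter_upwards with z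
        rw [indicator_of_notMem (by simpa using ht.ne'),
          indicator_of_notMem (fun hm => absurd hm.2 (not_le.2 ht))]
    · filter_upwards [Ioo_mem_nhdsLT (sub_one_lt x)] with z hz t
      by_cases ht : t ∈ Ioc z x
      · rw [indicator_of_mem ht, indicator_of_mem
          (show t ∈ Ioc (x - 1) x from ⟨hz.1.trans ht.1, ht.2⟩),
          Real.norm_eq_abs]
      · rw [indicator_of_notMem ht]; simp
  have hs : ∑' t : ℝ, ({x} : Set ℝ).indicator J t = J x := by
    rw [tsum_eq_single x (fun t ht => indicator_of_notMem (by simpa using ht) _)]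
    simp
  rw [hs] at key
  refine (key.const_sub (u x)).congr' ?_
  filter_upwards [self_mem_nhdsWithin] with z hz
  rw [← h.sub_eq z x (le_of_lt hz)]; ring

theorem leftLim_eq (h : HasJumps u J) (x : ℝ) : Function.leftLim u x = u x - J x :=
  leftLim_eq_of_tendsto (h.tendsto_left x)

theorem rightLim_eq (h : HasJumps u J) (x : ℝ) : Function.rightLim u x = u x :=
  rightLim_eq_of_tendsto (h.tendsto_right x)

theorem jumpHeight_eq (h : HasJumps u J) (x : ℝ) : jumpHeight u x = |J x| := by
  rw [jumpHeight, h.leftLim_eq, h.rightLim_eq, sub_sub_cancel]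

theorem continuousAt_iff (h : HasJumps u J) (x : ℝ) : ContinuousAt u x ↔ J x = 0 := by
  rw [continuousAt_iff_continuous_left'_right']
  constructor
  · intro hc
    have := tendsto_nhds_unique (h.tendsto_left x) hc.1
    linarith
  · intro hJ
    have := h.tendsto_left x
    rw [hJ, sub_zero] at this
    exact ⟨this, h.tendsto_right x⟩

theorem mem_jumpSet_iff (h : HasJumps u J) (x : ℝ) : x ∈ jumpSet u ↔ J x ≠ 0 := by
  rw [jumpSet, mem_ofPred_eq, h.continuousAt_iff]

/-- The jumps are determined by the function near the point. -/
theorem jump_eq_of_eventuallyEq (h : HasJumps u J) (h' : HasJumps s K) {x : ℝ}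
    (he : u =ᶠ[𝓝 x] s) : J x = K x := by
  have h1 := (h.tendsto_left x).congr' (he.filter_mono nhdsWithin_le_nhds)
  have := tendsto_nhds_unique h1 (h'.tendsto_left x)
  have h2 := he.self_of_nhds
  linarith

theorem const_mul (h : HasJumps u J) (c : ℝ) :
    HasJumps (fun x => c * u x) (fun x => c * J x) where
  summable a b := by
    have := (h.summable a b).mul_left c
    refine this.congr fun t => ?_
    by_cases ht : t ∈ Ioc a b <;> simp [ht]
  sub_eq a b hab := by
    rw [← mul_sub, h.sub_eq a b hab, ← tsum_mul_left]
    refine tsum_congr fun t => ?_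
    by_cases ht : t ∈ Ioc a b <;> simp [ht]

theorem of_summable (hJ : Summable J) (c : ℝ) :
    HasJumps (fun x => c + ∑' t, (Iic x).indicator J t) J where
  summable a b := hJ.indicator _
  sub_eq a b hab := by
    have : ∀ t, (Iic b).indicator J t = (Iic a).indicator J t + (Ioc a b).indicator J t := by
      intro t
      rw [← Iic_union_Ioc_eq_Iic hab, indicator_union_of_disjoint (Iic_disjoint_Ioc le_rfl)]
    rw [tsum_congr this, (hJ.indicator _).tsum_add (hJ.indicator _)]
    ring

end HasJumps

theorem HasJumps.pjloc {u J : ℝ → ℝ} (h : HasJumps u J) : PJloc u := by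
  intro a b hab
  have hs : Summable ((Ioo a b).indicator J) := by
    have := (h.summable a b).indicator (Ioo a b)
    rwa [indicator_indicator, inter_eq_left.2 Ioo_subset_Ioc_self] at this
  -- The constant is the right limit at the excluded endpoint `a`; restricting to the support
  -- ensures nonzero jumps.
  refine ⟨u a, Function.support ((Ioo a b).indicator J), J, ?_, hs.countable_support, ?_, ?_, ?_⟩
  · exact fun x hx => by_contra fun h' => hx (indicator_of_notMem h' _)
  · intro y hy h0
    exact hy (by rw [indicator_apply, h0, ite_self])
  · have : Summable (fun y : Function.support ((Ioo a b).indicator J) =>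
        |(Ioo a b).indicator J y|) := hs.abs.subtype _
    refine this.congr fun y => ?_
    have hy : (y : ℝ) ∈ Ioo a b := by_contra fun h' => y.2 (indicator_of_notMem h' _)
    rw [indicator_of_mem hy]
  · intro x hx
    have h1 := h.sub_eq a x hx.1.le
    have h2 : ∑' y : {y : ℝ // y ∈ Function.support ((Ioo a b).indicator J) ∧ y ≤ x}, J y
        = ∑' t, (Ioc a x).indicator J t := by
      have := tsum_subtype {y : ℝ | y ∈ Function.support ((Ioo a b).indicator J) ∧ y ≤ x} J
      refine Eq.trans this (tsum_congr fun t => ?_)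
      by_cases ht : t ∈ Ioc a x
      · have ht' : t ∈ Ioo a b := ⟨ht.1, ht.2.trans_lt hx.2⟩
        rw [indicator_of_mem ht]
        by_cases h0 : J t = 0
        · exact (indicator_apply_eq_zero.2 fun _ => h0).trans h0.symm
        · have hm : t ∈ Function.support ((Ioo a b).indicator J) := by
            rw [Function.mem_support, indicator_of_mem ht']; exact h0
          exact indicator_of_mem
            (show t ∈ {y : ℝ | y ∈ Function.support ((Ioo a b).indicator J) ∧ y ≤ x} from
              ⟨hm, ht.2⟩) _
      · rw [indicator_of_notMem ht, indicator_of_notMem]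
        rintro ⟨h3, h4⟩
        exact ht ⟨(by_contra fun h' => h3 (indicator_of_notMem
          (fun hm => h' hm.1) _)), h4⟩
    rw [h2, ← h1]; ring

theorem IsPureJumpOn.exists_summable {u : ℝ → ℝ} {a b : ℝ} (h : IsPureJumpOn a b u) :
    ∃ (c : ℝ) (J : ℝ → ℝ), Summable J ∧
      ∀ x ∈ Ioo a b, u x = c + ∑' t, (Iic x).indicator J t := by
  obtain ⟨c, S, J, -, -, -, hsum, hu⟩ := h
  refine ⟨c, S.indicator J, ?_, fun x hx => ?_⟩
  · exact summable_subtype_iff_indicator.1 (summable_abs_iff.1 hsum)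
  · rw [hu x hx]
    congr 1
    have := tsum_subtype {y : ℝ | y ∈ S ∧ y ≤ x} J
    refine Eq.trans this (tsum_congr fun t => ?_)
    rw [indicator_indicator]
    congr 1
    ext t; exact and_comm

/-- A locally pure jump function is determined up to a constant by its jumps. -/
theorem PJloc.hasJumps {u : ℝ → ℝ} (h : PJloc u) :
    HasJumps u (fun x => u x - Function.leftLim u x) := by
  have key : ∀ a b, a ≤ b → ∃ K, Summable K ∧ (∀ t ∈ Ioc a b, K t = u t - Function.leftLim u t) ∧
      u b - u a = ∑' t, (Ioc a b).indicator K t := by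
    intro a b hab
    -- The larger interval makes every point of `[a, b]` interior, so that left limits identify the
    -- local jumps `K` independently of the interval.
    obtain ⟨c, K, hK, hu⟩ := (h (a - 1) (b + 1) (by linarith)).exists_summable
    have hj := HasJumps.of_summable hK c
    refine ⟨K, hK, fun t ht => ?_, ?_⟩
    · have he : u =ᶠ[𝓝 t] fun x => c + ∑' t, (Iic x).indicator K t := by
        filter_upwards [Ioo_mem_nhds (show a - 1 < t by linarith [ht.1])
          (show t < b + 1 by linarith [ht.2])] with x hx using hu x hx
      have h1 := (hj.tendsto_left t).congr' (he.symm.filter_mono nhdsWithin_le_nhds)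
      have h2 := leftLim_eq_of_tendsto h1
      have h3 := he.self_of_nhds
      simp only at h3 h2
      rw [h2, h3]; ring
    · rw [← hj.sub_eq a b hab, hu a ⟨by linarith, by linarith⟩, hu b ⟨by linarith, by linarith⟩]
  constructor
  · intro a b
    rcases le_total a b with hab | hab
    · obtain ⟨K, hK, hKe, -⟩ := key a b hab
      refine (hK.indicator (Ioc a b)).congr fun t => ?_
      exact congrFun (indicator_congr hKe) t
    · rw [Ioc_eq_empty (not_lt.2 hab)]; simp
  · intro a b hab
    obtain ⟨K, hK, hKe, hs⟩ := key a b hab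
    rw [hs, indicator_congr hKe]

/-- At `a` the left limit `u a - J a` comes from `u` and the value from `s`, whence the jump there.
Applied twice, this produces the competitors of a minimizer. -/
theorem HasJumps.glue {u s J K : ℝ → ℝ} (h : HasJumps u J) (h' : HasJumps s K) (a : ℝ) :
    HasJumps (fun x => if x < a then u x else s x)
      (fun t => if t < a then J t else if t = a then s a - u a + J a else K t) := by
  set L : ℝ → ℝ := fun t => if t < a then J t else if t = a then s a - u a + J a else K t with hL
  have hright : ∀ x y, a ≤ x → (Ioc x y).indicator L = (Ioc x y).indicator K := by
    intro x y hx
    refine indicator_congr fun t ht => ?_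
    have : a < t := hx.trans_lt ht.1
    simp [hL, this.ne', this.not_gt]
  have hleft : ∀ x y, y < a → (Ioc x y).indicator L = (Ioc x y).indicator J := by
    intro x y hy
    refine indicator_congr fun t ht => ?_
    have : t < a := ht.2.trans_lt hy
    simp [hL, this]
  have hmid : ∀ x, x < a → ∀ t, (Ioc x a).indicator L t
      = (Ioc x a).indicator J t + (Pi.single a (s a - u a) : ℝ → ℝ) t := by
    intro x hx t
    by_cases ht : t ∈ Ioc x a
    · rw [indicator_of_mem ht, indicator_of_mem ht]
      rcases ht.2.lt_or_eq with h1 | h1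
      · simp [hL, h1, h1.ne]
      · subst h1; simp [hL]; ring
    · rw [indicator_of_notMem ht, indicator_of_notMem ht]
      have : t ≠ a := by rintro rfl; exact ht ⟨hx, le_rfl⟩
      simp [this]
  have hsing : HasSum (Pi.single a (s a - u a) : ℝ → ℝ) (s a - u a) := by
    exact hasSum_pi_single a _
  have hsplit : ∀ x y, x < a → a ≤ y → ∀ t, (Ioc x y).indicator L t
      = (Ioc x a).indicator L t + (Ioc a y).indicator L t := by
    intro x y hx hy t
    rw [← Ioc_union_Ioc_eq_Ioc hx.le hy, indicator_union_of_disjoint]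
    exact Ioc_disjoint_Ioc_of_le le_rfl
  have hsm : ∀ x, x < a → HasSum ((Ioc x a).indicator L) (s a - u x) := by
    intro x hx
    have h1 := (h.summable x a).hasSum.add hsing
    rw [← h.sub_eq x a hx.le] at h1
    have h2 : u a - u x + (s a - u a) = s a - u x := by ring
    rw [h2] at h1
    rwa [funext (hmid x hx)]
  have hsr : ∀ y, a ≤ y → HasSum ((Ioc a y).indicator L) (s y - s a) := by
    intro y hy
    rw [hright a y le_rfl, h'.sub_eq a y hy]
    exact (h'.summable _ _).hasSum
  constructor
  · intro x y
    rcases le_or_gt a x with hx | hx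
    · rw [hright x y hx]; exact h'.summable _ _
    · rcases lt_or_ge y a with hy | hy
      · rw [hleft x y hy]; exact h.summable _ _
      · rw [funext (hsplit x y hx hy)]
        exact ((hsm x hx).add (hsr y hy)).summable
  · intro x y hxy
    rcases le_or_gt a x with hx | hx
    · rw [hright x y hx, ← h'.sub_eq x y hxy]
      simp [hx.not_gt, (hx.trans hxy).not_gt]
    · rcases lt_or_ge y a with hy | hy
      · rw [hleft x y hy, ← h.sub_eq x y hxy]
        simp [hx, hy]
      · rw [funext (hsplit x y hx hy), ((hsm x hx).add (hsr y hy)).tsum_eq]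
        simp [hx, hy.not_gt]

end JumpFunctional

/-! ### Jump costs, energy on half-open intervals, and the chain rule for finitely many jumps. -/

namespace JumpFunctional

/-- The cost `|z| ^ θ` of a jump `z`, with the convention that the absence of a jump is free. -/
noncomputable def jumpCost (θ z : ℝ) : ℝ := if z = 0 then 0 else |z| ^ θ

theorem jumpCost_nonneg (θ z : ℝ) : 0 ≤ jumpCost θ z := by
  unfold jumpCost; split_ifs
  · exact le_rfl
  · positivity

@[simp] theorem jumpCost_zero (θ : ℝ) : jumpCost θ 0 = 0 := if_pos rfl

theorem jumpCost_of_ne {θ z : ℝ} (hz : z ≠ 0) : jumpCost θ z = |z| ^ θ := if_neg hz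

theorem jumpCost_neg (θ z : ℝ) : jumpCost θ (-z) = jumpCost θ z := by
  simp [jumpCost]

theorem jumpCost_le_rpow (θ z : ℝ) : jumpCost θ z ≤ |z| ^ θ := by
  unfold jumpCost; split_ifs
  · positivity
  · exact le_rfl

theorem jumpCost_mono {θ : ℝ} (hθ : 0 ≤ θ) {y z : ℝ} (h : |y| ≤ |z|) :
    jumpCost θ y ≤ jumpCost θ z := by
  by_cases hy : y = 0
  · rw [hy, jumpCost_zero]; exact jumpCost_nonneg _ _
  · have hz : z ≠ 0 := by rintro rfl; simp at h; exact hy h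
    rw [jumpCost_of_ne hy, jumpCost_of_ne hz]
    exact Real.rpow_le_rpow (abs_nonneg _) h hθ

/-- Subadditivity of `t ↦ t ^ θ`. It allows a corrective jump placed on top of an existing one to be
charged separately. -/
theorem jumpCost_add_le {θ : ℝ} (hθ : 0 ≤ θ) (hθ' : θ ≤ 1) (y z : ℝ) :
    jumpCost θ (y + z) ≤ jumpCost θ y + jumpCost θ z := by
  by_cases hy : y = 0
  · simp [hy]
  by_cases hz : z = 0
  · simp [hz]
  refine (jumpCost_le_rpow _ _).trans ?_
  rw [jumpCost_of_ne hy, jumpCost_of_ne hz]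
  exact (Real.rpow_le_rpow (abs_nonneg _) (abs_add_le y z) hθ).trans
    (Real.rpow_add_le_add_rpow (abs_nonneg _) (abs_nonneg _) hθ hθ')

theorem jumpCost_const_mul {c : ℝ} (hc : c ≠ 0) (θ z : ℝ) :
    jumpCost θ (c * z) = |c| ^ θ * jumpCost θ z := by
  by_cases hz : z = 0
  · simp [hz]
  · rw [jumpCost_of_ne hz, jumpCost_of_ne (mul_ne_zero hc hz), abs_mul,
      Real.mul_rpow (abs_nonneg _) (abs_nonneg _)]

/-- The total cost of the jumps `J` in the interval `(a, b]`. -/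
noncomputable def totalCost (θ : ℝ) (J : ℝ → ℝ) (a b : ℝ) : ℝ :=
  ∑' t, (Ioc a b).indicator (fun t => jumpCost θ (J t)) t

/-- The jumps `J` have finite total cost in the interval `(a, b]`. -/
def FiniteCost (θ : ℝ) (J : ℝ → ℝ) (a b : ℝ) : Prop :=
  Summable ((Ioc a b).indicator (fun t => jumpCost θ (J t)))

/-- The energy on the interval `(a, b]`, with slope one in the fidelity term. -/
noncomputable def energy (θ α β : ℝ) (u J : ℝ → ℝ) (a b : ℝ) : ℝ :=
  α * totalCost θ J a b + β * ∫ x in a..b, (u x - x) ^ 2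

theorem indicator_jumpCost_nonneg (θ : ℝ) (J : ℝ → ℝ) (s : Set ℝ) (t : ℝ) :
    0 ≤ s.indicator (fun t => jumpCost θ (J t)) t :=
  indicator_nonneg (fun _ _ => jumpCost_nonneg _ _) _

namespace HasJumps

variable {u s J K : ℝ → ℝ}

/-- Continuity holds off the support of `J`, which is countable and hence null. -/
theorem aestronglyMeasurable (h : HasJumps u J) : AEStronglyMeasurable u volume := by
  have hc : (Function.support J).Countable := by
    have : Function.support J ⊆
        ⋃ n : ℕ, Function.support ((Ioc (-(n : ℝ)) n).indicator J) := by
      intro t ht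
      obtain ⟨n, hn⟩ := exists_nat_gt |t|
      refine mem_iUnion.2 ⟨n, ?_⟩
      rw [Function.mem_support, indicator_of_mem]
      · exact ht
      · exact ⟨(abs_lt.1 hn).1, (abs_lt.1 hn).2.le⟩
    exact (countable_iUnion fun n => (h.summable _ _).countable_support).mono this
  have hco : ContinuousOn u (Function.support J)ᶜ := fun x hx =>
    ((h.continuousAt_iff x).2 (by simpa using hx)).continuousWithinAt
  have h1 := hco.aestronglyMeasurable (μ := volume) hc.measurableSet.compl
  rwa [Measure.restrict_eq_self_of_ae_mem] at h1
  exact (measure_eq_zero_iff_ae_notMem.1 (hc.measure_zero volume)).mono fun x hx => hx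

theorem abs_sub_le (h : HasJumps u J) {a b x : ℝ} (hx : x ∈ Icc a b) :
    |u x - u a| ≤ ∑' t, |(Ioc a b).indicator J t| := by
  rw [h.sub_eq a x hx.1]
  refine (norm_tsum_le_tsum_norm (h.summable a x).norm).trans ?_
  refine (h.summable a x).norm.tsum_le_tsum (fun t => ?_) (h.summable a b).abs
  by_cases ht : t ∈ Ioc a x
  · rw [indicator_of_mem ht, indicator_of_mem (show t ∈ Ioc a b from ⟨ht.1, ht.2.trans hx.2⟩),
      Real.norm_eq_abs]
  · rw [indicator_of_notMem ht]; simp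

theorem integrableOn_comp (h : HasJumps u J) {f : ℝ → ℝ} (hf : Continuous f) (a b : ℝ) :
    IntervalIntegrable (fun x => f (u x - x)) volume a b := by
  wlog hab : a ≤ b
  · exact (this h hf b a (le_of_not_ge hab)).symm
  rw [intervalIntegrable_iff_integrableOn_Ioc_of_le hab]
  set B := ∑' t, |(Ioc a b).indicator J t|
  obtain ⟨C, hC⟩ := (isCompact_Icc (a := u a - B - b) (b := u a + B - a)).exists_bound_of_continuousOn
    hf.continuousOn
  refine Measure.integrableOn_of_bounded (M := C) (by simp) ?_ ?_
  · exact hf.comp_aestronglyMeasurable (h.aestronglyMeasurable.sub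
      continuous_id.aestronglyMeasurable)
  · refine (ae_restrict_iff' measurableSet_Ioc).2 (Eventually.of_forall fun x hx => hC _ ?_)
    have := abs_le.1 (h.abs_sub_le (Ioc_subset_Icc_self hx))
    exact ⟨by linarith [this.1, hx.2], by linarith [this.2, hx.1]⟩

/-- The functional in terms of the jumps. -/
theorem jf_eq (h : HasJumps u J) (θ α β M : ℝ) (Ω : Set ℝ) :
    JF θ α β M Ω u = ENNReal.ofReal α *
        (∑' t, Ω.indicator (fun t => ENNReal.ofReal (jumpCost θ (J t))) t) +
      ENNReal.ofReal β * ∫⁻ x in Ω, ENNReal.ofReal ((u x - M * x) ^ 2) := by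
  unfold JF
  congr 2
  rw [tsum_subtype (jumpSet u ∩ Ω) (fun x => ENNReal.ofReal (jumpHeight u x ^ θ))]
  refine tsum_congr fun t => ?_
  by_cases ht : t ∈ Ω
  · rw [indicator_of_mem ht]
    by_cases h0 : J t = 0
    · rw [indicator_of_notMem fun hm => (h.mem_jumpSet_iff t).1 hm.1 h0, h0]; simp
    · rw [indicator_of_mem (show t ∈ jumpSet u ∩ Ω from ⟨(h.mem_jumpSet_iff t).2 h0, ht⟩),
        h.jumpHeight_eq, jumpCost_of_ne h0]
  · rw [indicator_of_notMem ht, indicator_of_notMem fun hm => ht hm.2]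

theorem jf_union (h : HasJumps u J) (θ α β M : ℝ) {A B : Set ℝ} (hAB : Disjoint A B)
    (hB : MeasurableSet B) : JF θ α β M (A ∪ B) u = JF θ α β M A u + JF θ α β M B u := by
  rw [h.jf_eq, h.jf_eq, h.jf_eq, lintegral_union hB hAB, indicator_union_of_disjoint hAB,
    ENNReal.tsum_add]
  ring

/-- Energies may be infinite and cannot be subtracted; splitting off the region where two functions
agree replaces the subtraction. -/
theorem jf_diff_add (h : HasJumps u J) (θ α β M : ℝ) {A B : Set ℝ} (hBA : B ⊆ A)
    (hB : MeasurableSet B) : JF θ α β M (A \ B) u + JF θ α β M B u = JF θ α β M A u := by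
  rw [← h.jf_union θ α β M disjoint_sdiff_left hB, sdiff_union_of_subset hBA]

theorem jf_congr (h : HasJumps u J) (h' : HasJumps s K) (θ α β M : ℝ) {A : Set ℝ}
    (hA : MeasurableSet A) (hu : ∀ x ∈ A, u x = s x) (hJ : ∀ x ∈ A, J x = K x) :
    JF θ α β M A u = JF θ α β M A s := by
  rw [h.jf_eq, h'.jf_eq]
  congr 2
  · refine tsum_congr fun t => ?_
    by_cases ht : t ∈ A
    · rw [indicator_of_mem ht, indicator_of_mem ht, hJ t ht]
    · rw [indicator_of_notMem ht, indicator_of_notMem ht]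
  · exact setLIntegral_congr_fun hA fun x hx => by simp only [hu x hx]

theorem jf_mono (h : HasJumps u J) (θ α β M : ℝ) {A B : Set ℝ} (hAB : A ⊆ B) :
    JF θ α β M A u ≤ JF θ α β M B u := by
  rw [h.jf_eq, h.jf_eq]
  gcongr

theorem jf_Ioc_eq_ofReal (h : HasJumps u J) {θ α β a b : ℝ} (hα : 0 ≤ α) (hβ : 0 ≤ β)
    (hab : a ≤ b) (hf : FiniteCost θ J a b) :
    JF θ α β 1 (Ioc a b) u = ENNReal.ofReal (energy θ α β u J a b) := by
  have h1 : ∑' t, (Ioc a b).indicator (fun t => ENNReal.ofReal (jumpCost θ (J t))) t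
      = ENNReal.ofReal (totalCost θ J a b) := by
    rw [totalCost, ENNReal.ofReal_tsum_of_nonneg (indicator_jumpCost_nonneg _ _ _) hf]
    refine tsum_congr fun t => ?_
    by_cases ht : t ∈ Ioc a b
    · rw [indicator_of_mem ht, indicator_of_mem ht]
    · rw [indicator_of_notMem ht, indicator_of_notMem ht, ENNReal.ofReal_zero]
  have h2 : ∫⁻ x in Ioc a b, ENNReal.ofReal ((u x - 1 * x) ^ 2)
      = ENNReal.ofReal (∫ x in a..b, (u x - x) ^ 2) := by
    rw [intervalIntegral.integral_of_le hab, ofReal_integral_eq_lintegral_ofReal]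
    · simp
    · exact (h.integrableOn_comp (f := fun y => y ^ 2) (by fun_prop) a b).1
    · exact Eventually.of_forall fun x => sq_nonneg _
  have h3 : 0 ≤ totalCost θ J a b := tsum_nonneg (indicator_jumpCost_nonneg _ _ _)
  have h4 : 0 ≤ ∫ x in a..b, (u x - x) ^ 2 :=
    intervalIntegral.integral_nonneg hab fun x _ => sq_nonneg _
  rw [h.jf_eq, h1, h2, ← ENNReal.ofReal_mul hα, ← ENNReal.ofReal_mul hβ,
    ← ENNReal.ofReal_add (by positivity) (by positivity), energy]

theorem finiteCost_of_jf_lt_top (h : HasJumps u J) {θ α β M a b : ℝ} (hα : 0 < α)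
    (hf : JF θ α β M (Ioc a b) u < ⊤) : FiniteCost θ J a b := by
  rw [h.jf_eq] at hf
  have h1 := (ENNReal.add_lt_top.1 hf).1
  have h2 : ∑' t, (Ioc a b).indicator (fun t => ENNReal.ofReal (jumpCost θ (J t))) t ≠ ⊤ := by
    intro h3
    rw [h3, ENNReal.mul_top (by simpa using hα)] at h1
    exact lt_irrefl _ h1
  have h3 := ENNReal.summable_toReal h2
  refine h3.congr fun t => ?_
  by_cases ht : t ∈ Ioc a b
  · rw [indicator_of_mem ht, indicator_of_mem ht, ENNReal.toReal_ofReal (jumpCost_nonneg _ _)]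
  · rw [indicator_of_notMem ht, indicator_of_notMem ht, ENNReal.toReal_zero]

end HasJumps

theorem energy_nonneg {θ α β : ℝ} (hα : 0 ≤ α) (hβ : 0 ≤ β) (u J : ℝ → ℝ) {a b : ℝ} (hab : a ≤ b) :
    0 ≤ energy θ α β u J a b := by
  have h3 : 0 ≤ totalCost θ J a b := tsum_nonneg (indicator_jumpCost_nonneg _ _ _)
  have h4 : 0 ≤ ∫ x in a..b, (u x - x) ^ 2 :=
    intervalIntegral.integral_nonneg hab fun x _ => sq_nonneg _
  unfold energy; positivity

theorem FiniteCost.mono {θ : ℝ} {J : ℝ → ℝ} {a b c d : ℝ} (h : FiniteCost θ J a d) (hab : a ≤ b)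
    (hcd : c ≤ d) : FiniteCost θ J b c := by
  have := Summable.indicator h (Ioc b c)
  rwa [indicator_indicator, inter_eq_left.2 (Ioc_subset_Ioc hab hcd)] at this

theorem totalCost_add {θ : ℝ} {J : ℝ → ℝ} {a b c : ℝ} (hab : a ≤ b) (hbc : b ≤ c)
    (hf : FiniteCost θ J a c) :
    totalCost θ J a c = totalCost θ J a b + totalCost θ J b c := by
  unfold totalCost
  rw [← Summable.tsum_add (hf.mono le_rfl hbc) (hf.mono hab le_rfl)]
  refine tsum_congr fun t => ?_
  rw [← Ioc_union_Ioc_eq_Ioc hab hbc, indicator_union_of_disjoint]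
  exact Ioc_disjoint_Ioc_of_le le_rfl

theorem energy_add {θ α β : ℝ} {u J : ℝ → ℝ} (h : HasJumps u J) {a b c : ℝ} (hab : a ≤ b)
    (hbc : b ≤ c) (hf : FiniteCost θ J a c) :
    energy θ α β u J a c = energy θ α β u J a b + energy θ α β u J b c := by
  have hi := fun a b => h.integrableOn_comp (f := fun y => y ^ 2) (by fun_prop) a b
  unfold energy
  rw [totalCost_add hab hbc hf, ← intervalIntegral.integral_add_adjacent_intervals (hi a b) (hi b c)]
  ring

/-- Chain rule for a function with finitely many jumps. -/
theorem HasJumps.chain_rule_finset {u J : ℝ → ℝ} (h : HasJumps u J) {Ψ ψ : ℝ → ℝ}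
    (hΨ : ∀ x, HasDerivAt Ψ (ψ x) x) (hψ : Continuous ψ) (b : ℝ) (F : Finset ℝ) :
    ∀ a, a ≤ b → (∀ t ∈ Ioc a b, J t ≠ 0 → t ∈ F) → (∀ t ∈ F, t ∈ Ioc a b) →
    Ψ (u a - a) - Ψ (u b - b) =
      ∑ t ∈ F, (Ψ (u t - J t - t) - Ψ (u t - t)) + ∫ x in a..b, ψ (u x - x) := by
  -- On a jump-free stretch `-Ψ (u a - x)` is a primitive of the integrand. A jump at `c` is
  -- allowed, since `u a - c` is the left limit of `u x - x` there.
  have base : ∀ a c, a ≤ c → (∀ t ∈ Ioo a c, J t = 0) →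
      ∫ x in a..c, ψ (u x - x) = Ψ (u a - a) - Ψ (u a - c) := by
    intro a c hac h0
    have hconst : ∀ x ∈ Ioo a c, u x = u a := by
      intro x hx
      have := h.sub_eq a x hx.1.le
      rw [tsum_congr (g := fun _ => (0 : ℝ)), tsum_zero] at this
      · linarith
      · intro t
        by_cases ht : t ∈ Ioc a x
        · rw [indicator_of_mem ht, h0 t ⟨ht.1, ht.2.trans_lt hx.2⟩]
        · rw [indicator_of_notMem ht]
    have e1 : ∫ x in a..c, ψ (u x - x) = ∫ x in a..c, ψ (u a - x) := by
      rw [intervalIntegral.integral_of_le hac, intervalIntegral.integral_of_le hac,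
        integral_Ioc_eq_integral_Ioo, integral_Ioc_eq_integral_Ioo]
      exact setIntegral_congr_fun measurableSet_Ioo fun x hx => by simp only [hconst x hx]
    have hd : ∀ x ∈ uIcc a c, HasDerivAt (fun y => -Ψ (u a - y)) (ψ (u a - x)) x := by
      intro x _
      have := ((hΨ (u a - x)).comp x ((hasDerivAt_id x).const_sub (u a))).neg
      rw [show -(ψ (u a - x) * -1) = ψ (u a - x) by ring] at this
      exact this
    rw [e1, intervalIntegral.integral_eq_sub_of_hasDerivAt hd
      ((by fun_prop : Continuous fun x => ψ (u a - x)).intervalIntegrable _ _)]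
    ring
  -- The leftmost jump `t` is peeled off: `base` handles `(a, t)`, and the induction hypothesis
  -- applies with left endpoint `t`.
  induction F using Finset.induction_on_min with
  | empty =>
    intro a hab h1 _
    have hz : ∀ t ∈ Ioc a b, J t = 0 := fun t ht => by_contra fun h' => by simpa using h1 t ht h'
    rw [base a b hab fun t ht => hz t (Ioo_subset_Ioc_self ht)]
    have hub : u b = u a := by
      have := h.sub_eq a b hab
      rw [tsum_congr (g := fun _ => (0 : ℝ)), tsum_zero] at this
      · linarith
      · intro t
        by_cases ht : t ∈ Ioc a b
        · rw [indicator_of_mem ht, hz t ht]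
        · rw [indicator_of_notMem ht]
    simp [hub]
  | insert t F hlt ih =>
    intro a hab h1 h2
    have ht := h2 t (Finset.mem_insert_self _ _)
    have hz : ∀ y ∈ Ioo a t, J y = 0 := by
      intro y hy
      by_contra h'
      rcases Finset.mem_insert.1 (h1 y ⟨hy.1, hy.2.le.trans ht.2⟩ h') with h3 | h3
      · exact hy.2.ne h3
      · exact absurd (hlt y h3) hy.2.not_gt
    have hi := ih t ht.2 ?_ ?_
    · have hut : u t - u a = J t := by
        rw [h.sub_eq a t ht.1.le, tsum_eq_single t, indicator_of_mem (right_mem_Ioc.2 ht.1)]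
        intro y hy
        by_cases hy' : y ∈ Ioc a t
        · rw [indicator_of_mem hy', hz y ⟨hy'.1, lt_of_le_of_ne hy'.2 hy⟩]
        · rw [indicator_of_notMem hy']
      rw [Finset.sum_insert (fun hm => lt_irrefl _ (hlt t hm)),
        ← intervalIntegral.integral_add_adjacent_intervals (h.integrableOn_comp hψ a t)
          (h.integrableOn_comp hψ t b), base a t ht.1.le hz]
      have : u t - J t - t = u a - t := by linarith
      rw [this]
      linarith
    · intro y hy hJ
      rcases Finset.mem_insert.1 (h1 y ⟨ht.1.trans hy.1, hy.2⟩ hJ) with h3 | h3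
      · exact absurd h3 hy.1.ne'
      · exact h3
    · intro y hy
      exact ⟨hlt y hy, (h2 y (Finset.mem_insert_of_mem hy)).2⟩

end JumpFunctional

/-! ### The calibration inequality, and the energy of staircases. -/

namespace JumpFunctional

/-- Truncating the jumps in `(a, b]` to finite sets approximates the function uniformly. -/
theorem HasJumps.exists_finset_approx {u J : ℝ → ℝ} (h : HasJumps u J) (a b : ℝ) {ε : ℝ}
    (hε : 0 < ε) : ∃ F : Finset ℝ, (∀ t ∈ F, t ∈ Ioc a b) ∧ ∃ v,
      HasJumps v ((F : Set ℝ).indicator J) ∧ ∀ x ∈ Icc a b, |v x - u x| ≤ ε := by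
  classical
  set J' := (Ioc a b).indicator J with hJ'
  have hs : Summable J' := h.summable a b
  -- A finite set carrying all but `ε` of the total variation on `(a, b]`.
  obtain ⟨F₀, hF₀⟩ := ((hs.abs.hasSum.eventually (lt_mem_nhds (sub_lt_self _ hε)))).exists
  set F := F₀.filter (· ∈ Ioc a b) with hF
  have hFJ : (F : Set ℝ).indicator J = (F₀ : Set ℝ).indicator J' := by
    ext t
    by_cases h1 : t ∈ F₀ <;> by_cases h2 : t ∈ Ioc a b <;>
      simp [hF, hJ', indicator_apply, h1] at h2 ⊢
  have hsF : Summable ((F : Set ℝ).indicator J) := by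
    rw [hFJ]; exact hs.indicator _
  refine ⟨F, fun t ht => (Finset.mem_filter.1 ht).2, _, HasJumps.of_summable hsF (u a), ?_⟩
  intro x hx
  have hux : u x = u a + ∑' t, (Iic x).indicator J' t := by
    have h1 := h.sub_eq a x hx.1
    have : (Iic x).indicator J' = (Ioc a x).indicator J := by
      rw [hJ', indicator_indicator]
      congr 1
      ext t
      exact ⟨fun ht => ⟨ht.2.1, ht.1⟩, fun ht => ⟨ht.2, ht.1, ht.2.trans hx.2⟩⟩
    rw [this, ← h1]; ring
  have hd : (u a + ∑' t, (Iic x).indicator ((F : Set ℝ).indicator J) t) - u x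
      = ∑' t, ((Iic x).indicator ((F : Set ℝ).indicator J) t - (Iic x).indicator J' t) := by
    rw [hux, (hsF.indicator _).tsum_sub (hs.indicator _)]; ring
  rw [hd]
  have hsd := (hsF.indicator (Iic x)).sub (hs.indicator (Iic x))
  have hsd' : Summable fun t => |J' t| - (F₀ : Set ℝ).indicator (fun t => |J' t|) t :=
    hs.abs.sub (hs.abs.indicator _)
  refine (norm_tsum_le_tsum_norm hsd.norm).trans ?_
  refine (hsd.norm.tsum_le_tsum (fun t => ?_) hsd').trans ?_
  · rw [hFJ, Real.norm_eq_abs]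
    by_cases h1 : t ∈ F₀ <;> by_cases h2 : t ≤ x <;> simp [h1, h2]
  · rw [hs.abs.tsum_sub (hs.abs.indicator _), ← tsum_subtype,
      show ∑' t : (F₀ : Set ℝ), |J' t| = _ from Finset.tsum_subtype' F₀ fun t => |J' t|]
    linarith

/-- The calibration inequality: a potential whose drops are controlled by the jump cost bounds
the cost of the jumps from below. -/
theorem HasJumps.calibration {u J : ℝ → ℝ} (h : HasJumps u J) {θ α : ℝ} (hα : 0 ≤ α)
    {Ψ ψ : ℝ → ℝ} (hΨ : ∀ x, HasDerivAt Ψ (ψ x) x) (hψ : Continuous ψ)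
    (hdrop : ∀ p q, Ψ p - Ψ q ≤ α * jumpCost θ (q - p)) {a b : ℝ} (hab : a ≤ b)
    (hf : FiniteCost θ J a b) :
    Ψ (u a - a) - Ψ (u b - b) ≤ α * totalCost θ J a b + ∫ x in a..b, ψ (u x - x) := by
  -- The exact chain rule is applied to truncations within `1 / (n + 1)` of `u`. Their jumps cost no
  -- more than those of `u`, and the integrals converge by dominated convergence.
  choose F hF v hv happ using fun n : ℕ => h.exists_finset_approx a b (ε := 1 / ((n : ℝ) + 1))
    (by positivity)
  have hlim : ∀ x ∈ Icc a b, Tendsto (fun n => v n x - x) atTop (𝓝 (u x - x)) := by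
    intro x hx
    refine Tendsto.sub_const ?_ x
    rw [tendsto_iff_dist_tendsto_zero]
    exact squeeze_zero (fun _ => dist_nonneg) (fun n => by rw [Real.dist_eq]; exact happ n x hx)
      tendsto_one_div_add_atTop_nhds_zero_nat
  have hΨc : Continuous Ψ := continuous_iff_continuousAt.2 fun x => (hΨ x).continuousAt
  have hle : ∀ n, Ψ (v n a - a) - Ψ (v n b - b)
      ≤ α * totalCost θ J a b + ∫ x in a..b, ψ (v n x - x) := by
    intro n
    rw [(hv n).chain_rule_finset hΨ hψ b (F n) a hab ?_ (hF n)]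
    · gcongr
      calc _ ≤ ∑ t ∈ F n, α * (Ioc a b).indicator (fun t => jumpCost θ (J t)) t := by
            refine Finset.sum_le_sum fun t ht => (hdrop _ _).trans (le_of_eq ?_)
            rw [indicator_of_mem (hF n t ht)]
            congr 2
            rw [indicator_of_mem (Finset.mem_coe.2 ht)]; ring
        _ = α * ∑ t ∈ F n, (Ioc a b).indicator (fun t => jumpCost θ (J t)) t := by
            rw [Finset.mul_sum]
        _ ≤ _ := by
            gcongr
            exact Summable.sum_le_tsum _ (fun t _ => indicator_jumpCost_nonneg _ _ _ _) hf
    · intro t _ h0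
      by_contra h'
      exact h0 (indicator_of_notMem (by simpa using h') _)
  have hint : Tendsto (fun n => ∫ x in a..b, ψ (v n x - x)) atTop
      (𝓝 (∫ x in a..b, ψ (u x - x))) := by
    set B := ∑' t, |(Ioc a b).indicator J t|
    obtain ⟨C, hC⟩ := (isCompact_Icc (a := u a - B - 1 - b)
      (b := u a + B + 1 - a)).exists_bound_of_continuousOn hψ.continuousOn
    refine intervalIntegral.tendsto_integral_filter_of_dominated_convergence (fun _ => C) ?_ ?_ ?_ ?_
    · refine Eventually.of_forall fun n => ?_
      exact ((hv n).integrableOn_comp hψ a b).def'.aestronglyMeasurable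
    · refine Eventually.of_forall fun n => Eventually.of_forall fun x hx => hC _ ?_
      rw [uIoc_of_le hab] at hx
      have h1 := abs_le.1 (h.abs_sub_le (Ioc_subset_Icc_self hx))
      have h2 := abs_le.1 (happ n x (Ioc_subset_Icc_self hx))
      have h3 : 1 / ((n : ℝ) + 1) ≤ 1 := by
        rw [div_le_one (by positivity)]; linarith [Nat.cast_nonneg (α := ℝ) n]
      exact ⟨by linarith [h1.1, h2.1, hx.2], by linarith [h1.2, h2.2, hx.1]⟩
    · exact intervalIntegrable_const
    · refine Eventually.of_forall fun x hx => ?_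
      rw [uIoc_of_le hab] at hx
      exact (hψ.tendsto _).comp (hlim x (Ioc_subset_Icc_self hx))
  exact le_of_tendsto_of_tendsto'
    (((hΨc.tendsto _).comp (hlim a (left_mem_Icc.2 hab))).sub
      ((hΨc.tendsto _).comp (hlim b (right_mem_Icc.2 hab))))
    (hint.const_add _) hle

/-- Lower bound for the energy by a calibrating potential. -/
theorem HasJumps.le_energy {u J : ℝ → ℝ} (h : HasJumps u J) {θ α β r : ℝ} (hα : 0 ≤ α)
    {Ψ ψ : ℝ → ℝ} (hΨ : ∀ x, HasDerivAt Ψ (ψ x) x) (hψ : Continuous ψ)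
    (hdrop : ∀ p q, Ψ p - Ψ q ≤ α * jumpCost θ (q - p)) {a b : ℝ} (hab : a ≤ b)
    (hf : FiniteCost θ J a b) (hr : ∀ x ∈ Icc a b, ψ (u x - x) ≤ β * (u x - x) ^ 2 - r) :
    r * (b - a) + Ψ (u a - a) - Ψ (u b - b) ≤ energy θ α β u J a b := by
  have h1 := h.calibration hα hΨ hψ hdrop hab hf
  have h2 : ∫ x in a..b, ψ (u x - x) ≤ ∫ x in a..b, (β * (u x - x) ^ 2 - r) :=
    intervalIntegral.integral_mono_on hab (h.integrableOn_comp hψ a b)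
      (h.integrableOn_comp (f := fun y => β * y ^ 2 - r) (by fun_prop) a b) hr
  rw [intervalIntegral.integral_sub
    (h.integrableOn_comp (f := fun y => β * y ^ 2) (by fun_prop) a b) (by simp),
    intervalIntegral.integral_const_mul, intervalIntegral.integral_const, smul_eq_mul] at h2
  rw [energy]
  linarith

/-- The staircase with steps of length and height `d` through the point `(c, c)`. -/
noncomputable def steps (d c x : ℝ) : ℝ := c + d * ⌊(x - c) / d + 1 / 2⌋

/-- The jumps of the staircase with steps of length and height `d`. -/
noncomputable def stepsJump (d c t : ℝ) : ℝ := if Int.fract ((t - c) / d + 1 / 2) = 0 then d else 0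

theorem abs_steps_sub_le {d : ℝ} (hd : 0 < d) (c x : ℝ) : |steps d c x - x| ≤ d / 2 := by
  have h1 := Int.floor_le ((x - c) / d + 1 / 2)
  have h2 := (Int.lt_floor_add_one ((x - c) / d + 1 / 2)).le
  have h3 : (x - c) = d * ((x - c) / d) := by field_simp
  rw [steps, abs_le]
  constructor <;> nlinarith

/-- The window is closed at `d / 2` because the staircase is right-continuous and takes its upper
value at a jump. -/
theorem steps_eq {d : ℝ} (hd : 0 < d) {c x : ℝ} {n : ℤ} (h1 : -(d / 2) < c + d * n - x)
    (h2 : c + d * n - x ≤ d / 2) : steps d c x = c + d * n := by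
  have : ⌊(x - c) / d + 1 / 2⌋ = n := by
    rw [Int.floor_eq_iff, ← sub_le_iff_le_add, le_div_iff₀ hd, ← lt_sub_iff_add_lt, div_lt_iff₀ hd]
    constructor <;> linarith
  rw [steps, this]

/-- The jump points of the staircase in `(a, b]`. -/
theorem exists_steps_jumps {d : ℝ} (hd : 0 < d) (c : ℝ) {a b : ℝ} (hab : a ≤ b) :
    ∃ F : Finset ℝ, (∀ t ∈ F, t ∈ Ioc a b) ∧ (∀ t ∈ Ioc a b, stepsJump d c t ≠ 0 → t ∈ F) ∧
      (∀ t ∈ F, stepsJump d c t = d ∧ steps d c t - t = d / 2) ∧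
      steps d c b - steps d c a = F.card * d := by
  set f : ℝ → ℝ := fun x => (x - c) / d + 1 / 2 with hf
  set g : ℤ → ℝ := fun k => c + d * (k - 1 / 2) with hg
  have hfg : ∀ k, f (g k) = k := by intro k; simp only [hf, hg]; field_simp; ring
  have hgf : ∀ x, c + d * (f x - 1 / 2) = x := by intro x; simp only [hf]; field_simp; ring
  have hmono : ∀ x y, f x ≤ f y ↔ x ≤ y := by
    intro x y
    simp only [hf, add_le_add_iff_right, div_le_div_iff_of_pos_right hd, sub_le_sub_iff_right]
  have hginj : Function.Injective g := by
    intro k l hkl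
    have := congrArg f hkl
    rw [hfg, hfg] at this
    exact_mod_cast this
  refine ⟨(Finset.Ioc ⌊f a⌋ ⌊f b⌋).map ⟨g, hginj⟩, ?_, ?_, ?_, ?_⟩
  · intro t ht
    obtain ⟨k, hk, rfl⟩ := Finset.mem_map.1 ht
    rw [Finset.mem_Ioc, Int.floor_lt, Int.le_floor, ← hfg k, hmono] at hk
    exact ⟨lt_of_not_ge fun h => absurd ((hmono _ _).2 h) (not_le.2 hk.1), hk.2⟩
  · intro t ht h0
    have h1 : Int.fract (f t) = 0 := by
      by_contra h'
      exact h0 (if_neg h')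
    have h2 : f t = ⌊f t⌋ := by
      have := Int.floor_add_fract (f t)
      rw [h1, add_zero] at this
      exact this.symm
    refine Finset.mem_map.2 ⟨⌊f t⌋, ?_, ?_⟩
    · rw [Finset.mem_Ioc, Int.floor_lt, ← h2]
      exact ⟨lt_of_not_ge fun h => absurd ((hmono _ _).1 h) (not_le.2 ht.1),
        Int.floor_le_floor ((hmono _ _).2 ht.2)⟩
    · change c + d * ((⌊f t⌋ : ℝ) - 1 / 2) = t
      rw [← h2, hgf]
  · intro t ht
    obtain ⟨k, -, rfl⟩ := Finset.mem_map.1 ht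
    constructor
    · refine if_pos ?_
      change Int.fract (f (g k)) = 0
      rw [hfg, Int.fract_intCast]
    · change c + d * (⌊f (g k)⌋ : ℝ) - g k = d / 2
      rw [hfg, Int.floor_intCast]
      simp only [hg]; ring
  · have hle : ⌊f a⌋ ≤ ⌊f b⌋ := Int.floor_le_floor ((hmono _ _).2 hab)
    have : (((Finset.Ioc ⌊f a⌋ ⌊f b⌋).map ⟨g, hginj⟩).card : ℝ) = (⌊f b⌋ : ℝ) - ⌊f a⌋ := by
      rw [Finset.card_map, Int.card_Ioc]
      have h1 : (((⌊f b⌋ - ⌊f a⌋).toNat : ℤ) : ℝ) = ((⌊f b⌋ - ⌊f a⌋ : ℤ) : ℝ) := by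
        rw [Int.toNat_of_nonneg (by linarith)]
      rw [Int.cast_natCast, Int.cast_sub] at h1
      exact h1
    rw [this]
    simp only [steps, hf]; ring

theorem hasSum_indicator_card_mul {f : ℝ → ℝ} {a b e : ℝ} {F : Finset ℝ}
    (h1 : ∀ t ∈ F, t ∈ Ioc a b) (h2 : ∀ t ∈ Ioc a b, f t ≠ 0 → t ∈ F) (h3 : ∀ t ∈ F, f t = e) :
    HasSum ((Ioc a b).indicator f) (F.card * e) := by
  have : (F.card : ℝ) * e = ∑ t ∈ F, (Ioc a b).indicator f t := by
    rw [Finset.sum_congr rfl fun t ht => (indicator_of_mem (h1 t ht) f).trans (h3 t ht)]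
    simp
  rw [this]
  refine hasSum_sum_of_ne_finset_zero fun t ht => ?_
  by_cases h : t ∈ Ioc a b
  · rw [indicator_of_mem h]
    exact by_contra fun h' => ht (h2 t h h')
  · exact indicator_of_notMem h _

theorem hasJumps_steps {d : ℝ} (hd : 0 < d) (c : ℝ) : HasJumps (steps d c) (stepsJump d c) := by
  constructor
  · intro a b
    rcases le_total a b with hab | hab
    · obtain ⟨F, h1, h2, h3, -⟩ := exists_steps_jumps hd c hab
      exact (hasSum_indicator_card_mul h1 h2 fun t ht => (h3 t ht).1).summable
    · rw [Ioc_eq_empty (not_lt.2 hab)]; simp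
  · intro a b hab
    obtain ⟨F, h1, h2, h3, h4⟩ := exists_steps_jumps hd c hab
    rw [h4, (hasSum_indicator_card_mul h1 h2 fun t ht => (h3 t ht).1).tsum_eq]

/-- The energy of the staircase with steps of length and height `d`. -/
theorem energy_steps {d : ℝ} (hd : 0 < d) (c : ℝ) {a b : ℝ} (hab : a ≤ b) (θ α β : ℝ) :
    FiniteCost θ (stepsJump d c) a b ∧ ∃ N : ℕ, steps d c b - steps d c a = N * d ∧
      energy θ α β (steps d c) (stepsJump d c) a b = N * (α * d ^ θ + β * d ^ 3 / 12) +
        β * ((steps d c a - a) ^ 3 - (steps d c b - b) ^ 3) / 3 := by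
  obtain ⟨F, h1, h2, h3, h4⟩ := exists_steps_jumps hd c hab
  have hs : HasSum ((Ioc a b).indicator fun t => jumpCost θ (stepsJump d c t))
      (F.card * d ^ θ) := by
    refine hasSum_indicator_card_mul h1 (fun t ht h0 => h2 t ht fun h' => h0 ?_) fun t ht => ?_
    · rw [h', jumpCost_zero]
    · rw [(h3 t ht).1, jumpCost_of_ne hd.ne', abs_of_pos hd]
  refine ⟨hs.summable, F.card, h4, ?_⟩
  -- With the potential `w ^ 3 / 3` the chain rule evaluates the fidelity integral; each jump from
  -- `-d / 2` to `d / 2` contributes `d ^ 3 / 12`.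
  have hΨ : ∀ x : ℝ, HasDerivAt (fun y : ℝ => y ^ 3 / 3) (x ^ 2) x := by
    intro x
    have := (hasDerivAt_pow 3 x).div_const 3
    exact this.congr_deriv (by norm_num)
  have hc := (hasJumps_steps hd c).chain_rule_finset hΨ (by fun_prop) b F a hab h2 h1
  rw [Finset.sum_congr rfl fun t ht => show _ = -(d ^ 3 / 12) by
    rw [show steps d c t - stepsJump d c t - t = -(d / 2) by
      linarith [(h3 t ht).1, (h3 t ht).2], (h3 t ht).2]; ring] at hc
  rw [Finset.sum_const, nsmul_eq_mul] at hc
  rw [energy, totalCost, hs.tsum_eq]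
  linear_combination (-β) * hc

end JumpFunctional

/-! ### The optimal step length and the calibrating potential. -/

namespace JumpFunctional

/-- The parameters of the problem, with `H` the optimal half-length of the steps. -/
structure OptimalStep (θ α β H : ℝ) : Prop where
  nonneg : 0 ≤ θ
  lt_one : θ < 1
  pos_cost : 0 < α
  pos_fidelity : 0 < β
  pos : 0 < H
  balance : (1 - θ) * (α * (2 * H) ^ θ) = 4 / 3 * β * H ^ 3

/-- The energy per unit length of the staircase with steps of length `2 * H`. -/
noncomputable def rate (θ α β H : ℝ) : ℝ := (α * (2 * H) ^ θ + 2 / 3 * β * H ^ 3) / (2 * H)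

/-- The excess energy of a step of length `d` over the optimal one. -/
noncomputable def stepExcess (θ α β H d : ℝ) : ℝ :=
  α * d ^ θ + β * d ^ 3 / 12 - rate θ α β H * d

namespace OptimalStep

variable {θ α β H : ℝ}

theorem rate_mul (h : OptimalStep θ α β H) :
    rate θ α β H * (2 * H) = α * (2 * H) ^ θ + 2 / 3 * β * H ^ 3 :=
  div_mul_cancel₀ _ (by linarith [h.pos])

theorem rate_pos (h : OptimalStep θ α β H) : 0 < rate θ α β H := by
  have := h.pos; have := h.pos_cost; have := h.pos_fidelity
  unfold rate; positivity

/-- Since `0 ≤ θ`, the balance gives `α * (2 * H) ^ θ ≥ 4 / 3 * β * H ^ 3`. This puts `[-H, H]`, the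
range of the optimal staircase relative to the identity, inside the cutoff. -/
theorem mul_sq_le_rate (h : OptimalStep θ α β H) : β * H ^ 2 ≤ rate θ α β H := by
  have h1 := h.rate_mul
  have h2 := h.balance
  have h3 : 0 ≤ θ * (α * (2 * H) ^ θ) := by
    have := h.pos; have := h.pos_cost; have := h.nonneg
    positivity
  refine le_of_mul_le_mul_right (a := 2 * H) ?_ (by linarith [h.pos])
  nlinarith

/-- Comparison of the steps of length `d` with the optimal ones, in terms of `t = d / (2 * H)`. -/
theorem stepExcess_eq (h : OptimalStep θ α β H) {t : ℝ} (ht : 0 < t) :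
    stepExcess θ α β H (2 * H * t)
      = α * (2 * H) ^ θ * t * (t ^ (-(1 - θ)) - (1 - (1 - θ) * ((t ^ 2 - 1) / 2))) := by
  have h1 := h.rate_mul
  have h2 := h.balance
  have h3 : (2 * H * t) ^ θ = (2 * H) ^ θ * (t * t ^ (-(1 - θ))) := by
    rw [Real.mul_rpow (by linarith [h.pos]) ht.le]
    rw [show t * t ^ (-(1 - θ)) = t ^ (1 : ℝ) * t ^ (-(1 - θ)) by rw [Real.rpow_one],
      ← Real.rpow_add ht, show 1 + -(1 - θ) = θ by ring]
  unfold stepExcess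
  rw [h3]
  linear_combination (-t) * h1 - (t * (t ^ 2 - 1) / 2) * h2

/-- Two tangent-line bounds suffice: `t ^ (-(1 - θ)) = exp (-(1 - θ) * log t) ≥ 1 - (1 - θ) * log t`
and `2 * log t ≤ t ^ 2 - 1`. -/
theorem stepExcess_nonneg (h : OptimalStep θ α β H) {d : ℝ} (hd : 0 < d) :
    0 ≤ stepExcess θ α β H d := by
  have hH := h.pos
  have hα := h.pos_cost
  have ht : 0 < d / (2 * H) := by positivity
  rw [show d = 2 * H * (d / (2 * H)) by field_simp, h.stepExcess_eq ht]
  refine mul_nonneg (by positivity) ?_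
  have h1 := Real.add_one_le_exp (Real.log (d / (2 * H)) * -(1 - θ))
  have h2 := Real.log_le_sub_one_of_pos (pow_pos ht 2)
  rw [Real.log_pow] at h2
  push_cast at h2
  rw [Real.rpow_def_of_pos ht]
  nlinarith [h.lt_one]

/-- The logarithmic bound is strict unless `t ^ 2 = 1`. -/
theorem eq_of_stepExcess_nonpos (h : OptimalStep θ α β H) {d : ℝ} (hd : 0 < d)
    (h0 : stepExcess θ α β H d ≤ 0) : d = 2 * H := by
  have hH := h.pos
  have hα := h.pos_cost
  have ht : 0 < d / (2 * H) := by positivity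
  rw [show d = 2 * H * (d / (2 * H)) by field_simp, h.stepExcess_eq ht] at h0
  have h3 := nonpos_of_mul_nonpos_right h0 (by positivity)
  have h1 := Real.add_one_le_exp (Real.log (d / (2 * H)) * -(1 - θ))
  rw [Real.rpow_def_of_pos ht] at h3
  by_contra hne
  have hne' : (d / (2 * H)) ^ 2 ≠ 1 := by
    intro h4
    have := (pow_eq_one_iff_of_nonneg ht.le two_ne_zero).1 h4
    rw [div_eq_one_iff_eq (by positivity)] at this
    exact hne this
  have h2 := Real.log_lt_sub_one_of_pos (pow_pos ht 2) hne'
  rw [Real.log_pow] at h2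
  push_cast at h2
  nlinarith [h.lt_one]

/-- The balance is the criticality condition for the energy per unit length. Hence stretching each
of `N` optimal steps by `O(1 / N)` costs `o(1)` in total. -/
theorem hasDerivAt_stepExcess (h : OptimalStep θ α β H) :
    HasDerivAt (stepExcess θ α β H) 0 (2 * H) := by
  have hH := h.pos
  have h1 := ((Real.hasDerivAt_rpow_const (p := θ) (Or.inl (show (2 * H) ≠ 0 by positivity))).const_mul
    α).add (((hasDerivAt_pow 3 (2 * H)).const_mul β).div_const 12)
  have h2 := h1.sub ((hasDerivAt_id (2 * H)).const_mul (rate θ α β H))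
  refine HasDerivAt.congr_deriv h2 ?_
  have h3 : (2 * H) ^ θ = (2 * H) ^ (θ - 1) * (2 * H) := by
    rw [← Real.rpow_add_one (by positivity)]; ring_nf
  have h4 := h.rate_mul
  have h5 := h.balance
  refine mul_right_cancel₀ (show (2 * H) ≠ 0 by positivity) ?_
  rw [h3] at h4 h5
  push_cast
  linear_combination -h4 - h5

theorem stepExcess_self (h : OptimalStep θ α β H) : stepExcess θ α β H (2 * H) = 0 := by
  rw [stepExcess, h.rate_mul]; ring

end OptimalStep

/-- The derivative of the calibrating potential. -/
noncomputable def slope (θ α β H w : ℝ) : ℝ := min 0 (β * w ^ 2 - rate θ α β H)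

/-- The calibrating potential. -/
noncomputable def potential (θ α β H w : ℝ) : ℝ := ∫ s in (0 : ℝ)..w, slope θ α β H s

/-- The range in which the potential is cubic. -/
noncomputable def cutoff (θ α β H : ℝ) : ℝ := √(rate θ α β H / β)

theorem continuous_slope (θ α β H : ℝ) : Continuous (slope θ α β H) := by
  unfold slope; fun_prop

theorem slope_nonpos (θ α β H w : ℝ) : slope θ α β H w ≤ 0 := min_le_left _ _

theorem slope_le (θ α β H w : ℝ) : slope θ α β H w ≤ β * w ^ 2 - rate θ α β H := min_le_right _ _

theorem hasDerivAt_potential (θ α β H w : ℝ) :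
    HasDerivAt (potential θ α β H) (slope θ α β H w) w :=
  ((continuous_slope θ α β H).integral_hasStrictDerivAt 0 w).hasDerivAt

theorem potential_sub (θ α β H p q : ℝ) :
    potential θ α β H p - potential θ α β H q = -∫ s in p..q, slope θ α β H s := by
  have hi := fun a b => (continuous_slope θ α β H).intervalIntegrable (μ := volume) a b
  unfold potential
  rw [intervalIntegral.integral_interval_sub_left (hi _ _) (hi _ _), intervalIntegral.integral_symm]

theorem potential_antitone (θ α β H : ℝ) : Antitone (potential θ α β H) := by
  intro p q hpq
  have h1 := potential_sub θ α β H p q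
  have h2 : 0 ≤ ∫ s in p..q, -slope θ α β H s :=
    intervalIntegral.integral_nonneg hpq fun s _ => neg_nonneg.2 (slope_nonpos _ _ _ _ s)
  rw [intervalIntegral.integral_neg] at h2
  linarith

namespace OptimalStep

variable {θ α β H : ℝ}

theorem cutoff_sq (h : OptimalStep θ α β H) : β * cutoff θ α β H ^ 2 = rate θ α β H := by
  have := h.pos_fidelity
  have := h.rate_pos
  rw [cutoff, Real.sq_sqrt (by positivity)]; field_simp

theorem le_cutoff (h : OptimalStep θ α β H) : H ≤ cutoff θ α β H := by
  refine Real.le_sqrt_of_sq_le ?_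
  rw [le_div_iff₀ h.pos_fidelity]
  linarith [h.mul_sq_le_rate]

theorem slope_eq_of_abs_le (h : OptimalStep θ α β H) {w : ℝ} (hw : |w| ≤ cutoff θ α β H) :
    slope θ α β H w = β * w ^ 2 - rate θ α β H := by
  refine min_eq_right ?_
  rw [← h.cutoff_sq, ← sq_abs w]
  have := h.pos_fidelity
  have := pow_le_pow_left₀ (abs_nonneg w) hw 2
  nlinarith

theorem slope_eq_zero (h : OptimalStep θ α β H) {w : ℝ} (hw : cutoff θ α β H ≤ |w|) :
    slope θ α β H w = 0 := by
  refine min_eq_left ?_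
  rw [← h.cutoff_sq, ← sq_abs w]
  have := h.pos_fidelity
  have hc : 0 ≤ cutoff θ α β H := Real.sqrt_nonneg _
  have := pow_le_pow_left₀ hc hw 2
  nlinarith

theorem potential_eq (h : OptimalStep θ α β H) {w : ℝ} (hw : |w| ≤ cutoff θ α β H) :
    potential θ α β H w = β * w ^ 3 / 3 - rate θ α β H * w := by
  have h1 : ∫ s in (0 : ℝ)..w, slope θ α β H s = ∫ s in (0 : ℝ)..w, (β * s ^ 2 - rate θ α β H) := by
    refine intervalIntegral.integral_congr fun s hs => h.slope_eq_of_abs_le ?_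
    have := abs_sub_left_of_mem_uIcc hs
    rw [sub_zero, sub_zero] at this
    exact this.trans hw
  rw [potential, h1, intervalIntegral.integral_sub
    ((by fun_prop : Continuous fun s : ℝ => β * s ^ 2).intervalIntegrable _ _) (by simp)]
  simp
  ring

/-- Clamping to the range in which the potential is cubic does not change the potential. -/
theorem potential_clamp (h : OptimalStep θ α β H) (w : ℝ) :
    potential θ α β H (max (-cutoff θ α β H) (min (cutoff θ α β H) w)) = potential θ α β H w := by
  have hc : 0 ≤ cutoff θ α β H := Real.sqrt_nonneg _
  by_cases hw : |w| ≤ cutoff θ α β H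
  · rw [min_eq_right (abs_le.1 hw).2, max_eq_right (abs_le.1 hw).1]
  rw [← sub_eq_zero, potential_sub, neg_eq_zero,
    intervalIntegral.integral_congr (g := fun _ => (0 : ℝ)), intervalIntegral.integral_zero]
  intro s hs
  refine h.slope_eq_zero ?_
  rcases lt_abs.1 (not_le.1 hw) with h2 | h2
  · rw [min_eq_left h2.le, max_eq_right (by linarith), uIcc_of_le h2.le] at hs
    exact le_abs.2 (Or.inl hs.1)
  · rw [min_eq_right (by linarith), max_eq_left (by linarith), uIcc_of_ge (by linarith)] at hs
    exact le_abs.2 (Or.inr (by linarith [hs.2]))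

/-- With `d = q - p`, `q ^ 3 - p ^ 3 = d ^ 3 / 4 + 3 / 4 * d * (p + q) ^ 2`. For `p < q` the two
subtracted terms are nonnegative defects: a wrong jump height and a jump not centred at zero. -/
theorem potential_sub_eq_of_abs_le (h : OptimalStep θ α β H) {p q : ℝ}
    (hp : |p| ≤ cutoff θ α β H) (hq : |q| ≤ cutoff θ α β H) :
    potential θ α β H p - potential θ α β H q = α * (q - p) ^ θ - stepExcess θ α β H (q - p)
      - β / 4 * (q - p) * (p + q) ^ 2 := by
  rw [h.potential_eq hp, h.potential_eq hq, stepExcess]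
  ring

/-- Drops of the potential are controlled by the jump cost. -/
theorem potential_drop (h : OptimalStep θ α β H) (p q : ℝ) :
    potential θ α β H p - potential θ α β H q ≤ α * jumpCost θ (q - p) := by
  have hα := h.pos_cost
  rcases le_or_gt q p with hqp | hpq
  · have := potential_antitone θ α β H hqp
    have := mul_nonneg hα.le (jumpCost_nonneg θ (q - p))
    linarith
  · have hc : 0 ≤ cutoff θ α β H := Real.sqrt_nonneg _
    -- Clamping keeps the potential and does not lengthen the jump, so the cubic formula covers
    -- every upward jump.
    rw [← h.potential_clamp p, ← h.potential_clamp q]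
    set c := cutoff θ α β H
    set p' := max (-c) (min c p) with hp'
    set q' := max (-c) (min c q) with hq'
    have hb : ∀ x, |max (-c) (min c x)| ≤ c := fun x =>
      abs_le.2 ⟨le_max_left _ _, max_le (by linarith) (min_le_left _ _)⟩
    have hle : p' ≤ q' := max_le_max le_rfl (min_le_min le_rfl hpq.le)
    have hdiff : |q' - p'| ≤ |q - p| := by
      have h1 := abs_max_sub_max_le_max (-c) (min c q) (-c) (min c p)
      have h2 := abs_min_sub_min_le_max c q c p
      simp only [sub_self, abs_zero, abs_nonneg, max_eq_right] at h1 h2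
      exact h1.trans h2
    rcases hle.eq_or_lt with he | hlt
    · rw [he, sub_self]
      exact mul_nonneg hα.le (jumpCost_nonneg θ (q - p))
    · rw [h.potential_sub_eq_of_abs_le (hb p) (hb q)]
      have h1 := h.stepExcess_nonneg (sub_pos.2 hlt)
      have h2 := mul_le_mul_of_nonneg_left (jumpCost_mono h.nonneg hdiff) hα.le
      rw [jumpCost_of_ne (sub_pos.2 hlt).ne', abs_of_pos (sub_pos.2 hlt)] at h2
      have h3 : 0 ≤ β / 4 * (q' - p') * (p' + q') ^ 2 := by
        have := h.pos_fidelity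
        have := sub_pos.2 hlt
        positivity
      linarith

theorem potential_bounded (h : OptimalStep θ α β H) :
    ∃ C, ∀ w, |potential θ α β H w| ≤ C := by
  obtain ⟨C, hC⟩ := (isCompact_Icc (a := -cutoff θ α β H)
    (b := cutoff θ α β H)).exists_bound_of_continuousOn (f := potential θ α β H)
    (fun x _ => (hasDerivAt_potential θ α β H x).continuousAt.continuousWithinAt)
  refine ⟨C, fun w => ?_⟩
  have hc : 0 ≤ cutoff θ α β H := Real.sqrt_nonneg _
  rw [← h.potential_clamp w]
  exact hC _ ⟨le_max_left _ _, max_le (by linarith) (min_le_left _ _)⟩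

/-- Equality for a jump within the range in which the potential is cubic. -/
theorem eq_of_cost_le_potential_sub (h : OptimalStep θ α β H) {p q : ℝ} (hpq : p ≠ q)
    (hp : |p| ≤ cutoff θ α β H) (hq : |q| ≤ cutoff θ α β H)
    (hle : α * jumpCost θ (q - p) ≤ potential θ α β H p - potential θ α β H q) :
    p = -H ∧ q = H := by
  have hα := h.pos_cost
  have hne : q - p ≠ 0 := sub_ne_zero.2 hpq.symm
  have hpos : 0 < α * jumpCost θ (q - p) := by
    rw [jumpCost_of_ne hne]; positivity
  have hlt : p < q := by
    by_contra h'
    have := potential_antitone θ α β H (not_lt.1 h')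
    linarith
  have hd := sub_pos.2 hlt
  rw [h.potential_sub_eq_of_abs_le hp hq, jumpCost_of_ne hne, abs_of_pos hd] at hle
  have h1 := h.stepExcess_nonneg hd
  have hβ := h.pos_fidelity
  have h3 : 0 ≤ β / 4 * (q - p) * (p + q) ^ 2 := by positivity
  have h4 := h.eq_of_stepExcess_nonpos hd (by linarith)
  have h5 : (p + q) ^ 2 ≤ 0 := by
    by_contra h'
    have : 0 < β / 4 * (q - p) * (p + q) ^ 2 := mul_pos (by positivity) (not_le.1 h')
    linarith
  have h6 : p + q = 0 := by nlinarith
  constructor <;> linarith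

/-- The energy is bounded below by the rate and the boundary values of the potential. -/
theorem le_energy (h : OptimalStep θ α β H) {u J : ℝ → ℝ} (hu : HasJumps u J) {a b : ℝ}
    (hab : a ≤ b) (hf : FiniteCost θ J a b) :
    rate θ α β H * (b - a) + potential θ α β H (u a - a) - potential θ α β H (u b - b)
      ≤ energy θ α β u J a b :=
  hu.le_energy h.pos_cost.le (hasDerivAt_potential θ α β H) (continuous_slope θ α β H)
    h.potential_drop hab hf fun _ _ => slope_le _ _ _ _ _

/-- The energy of the optimal staircases. -/
theorem energy_steps_eq (h : OptimalStep θ α β H) (c : ℝ) {a b : ℝ} (hab : a ≤ b) :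
    energy θ α β (steps (2 * H) c) (stepsJump (2 * H) c) a b =
      rate θ α β H * (b - a) + potential θ α β H (steps (2 * H) c a - a)
        - potential θ α β H (steps (2 * H) c b - b) := by
  have hH : 0 < 2 * H := by linarith [h.pos]
  obtain ⟨-, N, hN, hE⟩ := energy_steps hH c hab θ α β
  have hb : ∀ x, |steps (2 * H) c x - x| ≤ cutoff θ α β H := fun x =>
    (abs_steps_sub_le hH c x).trans (by linarith [h.le_cutoff])
  rw [hE, h.potential_eq (hb a), h.potential_eq (hb b)]
  have := h.rate_mul
  linear_combination (-N : ℝ) * this - rate θ α β H * hN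

end OptimalStep

end JumpFunctional

/-! ### Minimality of the optimal staircases, and comparison of a minimizer with competitors. -/

namespace JumpFunctional

variable {θ α β H : ℝ}

/-- The optimal staircases are entire local minimizers. -/
theorem OptimalStep.isEntireLocalMinimizer_steps (h : OptimalStep θ α β H) (c : ℝ) :
    IsEntireLocalMinimizer θ α β 1 (steps (2 * H) c) := by
  have hH : 0 < 2 * H := by linarith [h.pos]
  have hs := hasJumps_steps hH c
  have hfin : ∀ a b, a ≤ b → JF θ α β 1 (Ioc a b) (steps (2 * H) c) < ⊤ := by
    intro a b hab
    rw [hs.jf_Ioc_eq_ofReal h.pos_cost.le h.pos_fidelity.le hab (energy_steps hH c hab θ α β).1]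
    exact ENNReal.ofReal_lt_top
  refine ⟨hs.pjloc, ?_, ?_⟩
  · intro Ω _ hb
    obtain ⟨r, hr⟩ := hb.subset_closedBall 0
    rw [Real.closedBall_eq_Icc] at hr
    have hsub : Ω ⊆ Ioc (-|r| - 1) |r| := hr.trans fun x hx =>
      ⟨by linarith [hx.1, le_abs_self r], by linarith [hx.2, le_abs_self r]⟩
    exact (hs.jf_mono θ α β 1 hsub).trans_lt (hfin _ _ (by linarith [abs_nonneg r]))
  · rintro Ω hΩ v hv ⟨K, hK, hKΩ, hveq⟩
    have hvJ := hv.hasJumps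
    set L := fun x => v x - Function.leftLim v x
    have hJ : ∀ x ∉ K, L x = stepsJump (2 * H) c x := fun x hx =>
      hvJ.jump_eq_of_eventuallyEq hs
        (mem_of_superset (hK.isClosed.isOpen_compl.mem_nhds hx) fun y hy => hveq y hy)
    obtain ⟨r, hr⟩ := hK.isBounded.subset_closedBall 0
    rw [Real.closedBall_eq_Icc] at hr
    set R := |r| + 1 with hR
    have hKR : K ⊆ Ioo (-R) R := hr.trans fun x hx =>
      ⟨by linarith [hx.1, le_abs_self r], by linarith [hx.2, le_abs_self r]⟩
    have hRpos : -R ≤ R := by have := abs_nonneg r; linarith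
    -- Both functions agree at `±R`, so the calibrated lower bound for `v` is exactly the energy of
    -- the staircase.
    have key : JF θ α β 1 (Ioc (-R) R) (steps (2 * H) c) ≤ JF θ α β 1 (Ioc (-R) R) v := by
      rcases eq_top_or_lt_top (JF θ α β 1 (Ioc (-R) R) v) with htop | hlt
      · rw [htop]; exact le_top
      · have hf := hvJ.finiteCost_of_jf_lt_top h.pos_cost hlt
        rw [hs.jf_Ioc_eq_ofReal h.pos_cost.le h.pos_fidelity.le hRpos
          (energy_steps hH c hRpos θ α β).1,
          hvJ.jf_Ioc_eq_ofReal h.pos_cost.le h.pos_fidelity.le hRpos hf]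
        refine ENNReal.ofReal_le_ofReal ?_
        rw [h.energy_steps_eq c hRpos, ← hveq (-R) fun hm => lt_irrefl _ (hKR hm).1,
          ← hveq R fun hm => lt_irrefl _ (hKR hm).2]
        exact h.le_energy hvJ hRpos hf
    have hcongr : ∀ A, MeasurableSet A → JF θ α β 1 (A \ K) (steps (2 * H) c)
        = JF θ α β 1 (A \ K) v := fun A hA =>
      hs.jf_congr hvJ θ α β 1 (hA.diff hK.measurableSet) (fun x hx => (hveq x hx.2).symm)
        fun x hx => (hJ x hx.2).symm
    have hKI : K ⊆ Ioc (-R) R := hKR.trans Ioo_subset_Ioc_self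
    -- The common energy on `(-R, R] \ K` is finite and cancels. That on `Ω \ K` may be infinite,
    -- but it is only added back.
    have hKle : JF θ α β 1 K (steps (2 * H) c) ≤ JF θ α β 1 K v := by
      rw [← hs.jf_diff_add θ α β 1 hKI hK.measurableSet,
        ← hvJ.jf_diff_add θ α β 1 hKI hK.measurableSet, hcongr _ measurableSet_Ioc] at key
      refine (ENNReal.add_le_add_iff_left ?_).1 key
      rw [← hcongr _ measurableSet_Ioc]
      exact ((hs.jf_mono θ α β 1 sdiff_subset).trans_lt (hfin _ _ hRpos)).ne
    rw [← hs.jf_diff_add θ α β 1 hKΩ hK.measurableSet,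
      ← hvJ.jf_diff_add θ α β 1 hKΩ hK.measurableSet, hcongr _ hΩ.measurableSet]
    gcongr

theorem IsEntireLocalMinimizer.jf_Ioc_lt_top {u : ℝ → ℝ} {M : ℝ}
    (hu : IsEntireLocalMinimizer θ α β M u) (a b : ℝ) : JF θ α β M (Ioc a b) u < ⊤ :=
  (hu.1.hasJumps.jf_mono θ α β M (show Ioc a b ⊆ Ioo a (b + 1) from
    fun _ hx => ⟨hx.1, hx.2.trans_lt (lt_add_one b)⟩)).trans_lt
    (hu.2.1 (Ioo a (b + 1)) isOpen_Ioo (Metric.isBounded_Ioo _ _))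

theorem IsEntireLocalMinimizer.finiteCost {u J : ℝ → ℝ} (hα : 0 < α)
    (hu : IsEntireLocalMinimizer θ α β 1 u) (hJ : HasJumps u J) (a b : ℝ) : FiniteCost θ J a b :=
  hJ.finiteCost_of_jf_lt_top hα (hu.jf_Ioc_lt_top a b)

/-- Comparison of a minimizer with a competitor `s` on `[a, b)`, the mismatch at the endpoints
being paid by additional jumps. -/
theorem IsEntireLocalMinimizer.energy_le {u J s K : ℝ → ℝ} (hθ : 0 ≤ θ) (hθ' : θ ≤ 1) (hα : 0 < α)
    (hβ : 0 < β) (hu : IsEntireLocalMinimizer θ α β 1 u) (hJ : HasJumps u J) (hs : HasJumps s K)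
    {a b : ℝ} (hab : a < b) (hK : FiniteCost θ K a b) :
    energy θ α β u J a b ≤ α * jumpCost θ (s a - u a) + energy θ α β s K a b
      + α * jumpCost θ (u b - s b) := by
  have hv := (hJ.glue hs a).glue hJ b
  set v := fun x => if x < b then (fun x => if x < a then u x else s x) x else u x with hvdef
  set L := fun t => if t < b then
    (fun t => if t < a then J t else if t = a then s a - u a + J a else K t) t
    else if t = b then u b - (fun x => if x < a then u x else s x) b +
      (fun t => if t < a then J t else if t = a then s a - u a + J a else K t) b else J t with hL
  have hvl : ∀ x < a, v x = u x := fun x hx => by simp [hvdef, hx, hx.trans hab]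
  have hvm : ∀ x, a ≤ x → x < b → v x = s x := fun x hx hx' => by simp [hvdef, hx', hx.not_gt]
  have hvr : ∀ x, b ≤ x → v x = u x := fun x hx => by simp [hvdef, hx.not_gt]
  have hLl : ∀ t < a, L t = J t := fun t ht => by simp [hL, ht, ht.trans hab]
  have hLa : L a = s a - u a + J a := by simp [hL, hab]
  have hLm : ∀ t, a < t → t < b → L t = K t := fun t ht ht' => by
    simp [hL, ht', ht.not_gt, ht.ne']
  have hLb : L b = u b - s b + K b := by simp [hL, hab.not_gt, hab.ne']
  have hLr : ∀ t, b < t → L t = J t := fun t ht => by simp [hL, ht.not_gt, ht.ne']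
  -- The interval starts at `a - 1` because `(a, b]` would miss the modified jump at `a`.
  have hfu := hu.finiteCost hα hJ (a - 1) b
  -- A majorant of the competitor's jump cost: at `a` and `b` an old jump and its correction are
  -- charged separately.
  set D : ℝ → ℝ := fun t => (Ioc (a - 1) a).indicator (fun t => jumpCost θ (J t)) t +
    (Ioc a b).indicator (fun t => jumpCost θ (K t)) t +
    (Pi.single a (jumpCost θ (s a - u a)) : ℝ → ℝ) t +
    (Pi.single b (jumpCost θ (u b - s b)) : ℝ → ℝ) t with hD
  have hDs : HasSum D (totalCost θ J (a - 1) a + totalCost θ K a b + jumpCost θ (s a - u a) +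
      jumpCost θ (u b - s b)) :=
    (((Summable.hasSum (hfu.mono le_rfl hab.le)).add hK.hasSum).add
      (hasSum_pi_single a _)).add (hasSum_pi_single b _)
  have hLD : ∀ t, (Ioc (a - 1) b).indicator (fun t => jumpCost θ (L t)) t ≤ D t := by
    intro t
    have hDnn : 0 ≤ D t := by
      have h1 := indicator_jumpCost_nonneg θ J (Ioc (a - 1) a) t
      have h2 := indicator_jumpCost_nonneg θ K (Ioc a b) t
      have h3 : 0 ≤ (Pi.single a (jumpCost θ (s a - u a)) : ℝ → ℝ) t := by
        rw [Pi.single_apply]; split_ifs; exacts [jumpCost_nonneg _ _, le_rfl]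
      have h4 : 0 ≤ (Pi.single b (jumpCost θ (u b - s b)) : ℝ → ℝ) t := by
        rw [Pi.single_apply]; split_ifs; exacts [jumpCost_nonneg _ _, le_rfl]
      simp only [hD]; positivity
    by_cases ht : t ∈ Ioc (a - 1) b
    · rw [indicator_of_mem ht]
      rcases lt_trichotomy t a with h1 | h1 | h1
      · simp only [hLl t h1, hD]
        rw [indicator_of_mem (show t ∈ Ioc (a - 1) a from ⟨ht.1, h1.le⟩),
          indicator_of_notMem (fun hm => h1.not_gt hm.1), Pi.single_eq_of_ne h1.ne,
          Pi.single_eq_of_ne (h1.trans hab).ne]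
        simp
      · subst h1
        simp only [hLa, hD]
        rw [indicator_of_mem (show t ∈ Ioc (t - 1) t from ⟨ht.1, le_rfl⟩),
          indicator_of_notMem (fun hm => lt_irrefl _ hm.1), Pi.single_eq_same,
          Pi.single_eq_of_ne hab.ne]
        linarith [jumpCost_add_le hθ hθ' (s t - u t) (J t)]
      · rcases ht.2.lt_or_eq with h2 | h2
        · simp only [hLm t h1 h2, hD]
          rw [indicator_of_notMem (fun hm => h1.not_ge hm.2),
            indicator_of_mem (show t ∈ Ioc a b from ⟨h1, ht.2⟩), Pi.single_eq_of_ne h1.ne',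
            Pi.single_eq_of_ne h2.ne]
          simp
        · subst h2
          simp only [hLb, hD]
          rw [indicator_of_notMem (fun hm => h1.not_ge hm.2),
            indicator_of_mem (show t ∈ Ioc a t from ⟨h1, ht.2⟩), Pi.single_eq_of_ne h1.ne',
            Pi.single_eq_same]
          linarith [jumpCost_add_le hθ hθ' (u t - s t) (K t)]
    · rw [indicator_of_notMem ht]; exact hDnn
  have hfL : FiniteCost θ L (a - 1) b :=
    Summable.of_nonneg_of_le (indicator_jumpCost_nonneg _ _ _) hLD hDs.summable
  have hcost : totalCost θ L (a - 1) b ≤ totalCost θ J (a - 1) a + totalCost θ K a b +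
      jumpCost θ (s a - u a) + jumpCost θ (u b - s b) :=
    (hfL.tsum_le_tsum hLD hDs.summable).trans_eq hDs.tsum_eq
  have hiv := fun a b => hv.integrableOn_comp (f := fun y => y ^ 2) (by fun_prop) a b
  have hint : ∫ x in (a - 1)..b, (v x - x) ^ 2
      = (∫ x in (a - 1)..a, (u x - x) ^ 2) + ∫ x in a..b, (s x - x) ^ 2 := by
    rw [← intervalIntegral.integral_add_adjacent_intervals (hiv (a - 1) a) (hiv a b)]
    congr 1
    · rw [intervalIntegral.integral_of_le (by linarith), intervalIntegral.integral_of_le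
        (by linarith), integral_Ioc_eq_integral_Ioo, integral_Ioc_eq_integral_Ioo]
      exact setIntegral_congr_fun measurableSet_Ioo fun x hx => by simp only [hvl x hx.2]
    · rw [intervalIntegral.integral_of_le hab.le, intervalIntegral.integral_of_le
        hab.le, integral_Ioc_eq_integral_Ioo, integral_Ioc_eq_integral_Ioo]
      exact setIntegral_congr_fun measurableSet_Ioo fun x hx => by simp only [hvm x hx.1.le hx.2]
  have hmin := hu.2.2 (Ioo (a - 2) (b + 1)) isOpen_Ioo v hv.pjloc ⟨Icc a b, isCompact_Icc,
    fun x hx => ⟨by linarith [hx.1], by linarith [hx.2]⟩, fun x hx => by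
      rcases lt_or_ge x a with h1 | h1
      · exact hvl x h1
      · exact hvr x (le_of_not_ge fun h2 => hx ⟨h1, h2⟩)⟩
  have hsub : Ioc (a - 1) b ⊆ Ioo (a - 2) (b + 1) := fun x hx =>
    ⟨by linarith [hx.1], by linarith [hx.2]⟩
  rw [← hJ.jf_diff_add θ α β 1 hsub measurableSet_Ioc,
    ← hv.jf_diff_add θ α β 1 hsub measurableSet_Ioc,
    ← hJ.jf_congr hv θ α β 1 (measurableSet_Ioo.diff measurableSet_Ioc) ?_ ?_,
    ENNReal.add_le_add_iff_left, hJ.jf_Ioc_eq_ofReal hα.le hβ.le (by linarith) hfu,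
    hv.jf_Ioc_eq_ofReal hα.le hβ.le (by linarith) hfL,
    ENNReal.ofReal_le_ofReal_iff (energy_nonneg hα.le hβ.le _ _ (by linarith)),
    energy_add hJ (by linarith : a - 1 ≤ a) hab.le hfu] at hmin
  · simp only [energy] at hmin ⊢
    rw [hint] at hmin
    have := mul_le_mul_of_nonneg_left hcost hα.le
    linarith
  · exact ((hJ.jf_mono θ α β 1 sdiff_subset).trans_lt
      (hu.2.1 _ isOpen_Ioo (Metric.isBounded_Ioo _ _))).ne
  · intro x hx
    rcases le_or_gt x (a - 1) with h1 | h1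
    · exact (hvl x (by linarith)).symm
    · exact (hvr x (le_of_not_ge fun h2 => hx.2 ⟨h1, h2⟩)).symm
  · intro x hx
    rcases le_or_gt x (a - 1) with h1 | h1
    · exact (hLl x (by linarith)).symm
    · exact (hLr x (lt_of_not_ge fun h2 => hx.2 ⟨h1, h2⟩)).symm

end JumpFunctional

/-! ### Minimizers come back within distance `H` of the identity in both directions. -/

namespace JumpFunctional

/-- A regularization of `|w| ^ θ`. -/
noncomputable def smoothCost (θ w : ℝ) : ℝ := (1 + w ^ 2) ^ (θ / 2)

theorem smoothCost_eq (θ w : ℝ) : smoothCost θ w = √(1 + w ^ 2) ^ θ := by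
  rw [smoothCost, Real.sqrt_eq_rpow, ← Real.rpow_mul (by positivity)]
  congr 1; ring

theorem smoothCost_mono {θ : ℝ} (hθ : 0 ≤ θ) {p q : ℝ} (h : |p| ≤ |q|) :
    smoothCost θ p ≤ smoothCost θ q := by
  unfold smoothCost
  exact Real.rpow_le_rpow (by positivity) (by linarith [sq_le_sq.2 h]) (by linarith)

theorem jumpCost_le_smoothCost {θ : ℝ} (hθ : 0 ≤ θ) (w : ℝ) : jumpCost θ w ≤ smoothCost θ w := by
  refine (jumpCost_le_rpow θ w).trans ?_
  rw [smoothCost_eq]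
  exact Real.rpow_le_rpow (abs_nonneg _) (Real.abs_le_sqrt (by linarith)) hθ

/-- `√(1 + w ^ 2)` is 1-Lipschitz and `t ↦ t ^ θ` is subadditive; thus `±α * smoothCost` are
admissible potentials. -/
theorem smoothCost_sub_le {θ : ℝ} (hθ : 0 ≤ θ) (hθ' : θ ≤ 1) (p q : ℝ) :
    smoothCost θ p - smoothCost θ q ≤ jumpCost θ (q - p) := by
  by_cases hpq : q - p = 0
  · rw [sub_eq_zero.1 hpq]; simp
  rw [jumpCost_of_ne hpq, smoothCost_eq, smoothCost_eq, sub_le_iff_le_add']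
  refine le_trans (Real.rpow_le_rpow (by positivity) ?_ hθ)
    (Real.rpow_add_le_add_rpow (Real.sqrt_nonneg _) (abs_nonneg (q - p)) hθ hθ')
  have h1 := Real.sq_sqrt (show 0 ≤ 1 + q ^ 2 by positivity)
  have h2 : |q| ≤ √(1 + q ^ 2) := Real.abs_le_sqrt (by linarith)
  refine Real.sqrt_le_iff.2 ⟨by positivity, ?_⟩
  have h3 : |q * (q - p)| ≤ √(1 + q ^ 2) * |q - p| := by
    rw [abs_mul]; exact mul_le_mul_of_nonneg_right h2 (abs_nonneg _)
  nlinarith [sq_abs (q - p), neg_abs_le (q * (q - p))]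

theorem hasDerivAt_smoothCost (θ w : ℝ) :
    HasDerivAt (smoothCost θ) (2 * w * (θ / 2) * (1 + w ^ 2) ^ (θ / 2 - 1)) w := by
  have h1 : HasDerivAt (fun w : ℝ => 1 + w ^ 2) (2 * w) w := by
    simpa using (hasDerivAt_pow 2 w).const_add 1
  exact h1.rpow_const (Or.inl (by positivity))

theorem abs_deriv_smoothCost_le {θ : ℝ} (hθ : 0 ≤ θ) (hθ' : θ ≤ 1) (w : ℝ) :
    |2 * w * (θ / 2) * (1 + w ^ 2) ^ (θ / 2 - 1)| ≤ 1 := by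
  have h1 : |w| * (1 + w ^ 2) ^ (θ / 2 - 1) ≤ 1 := by
    calc |w| * (1 + w ^ 2) ^ (θ / 2 - 1) ≤ (1 + w ^ 2) ^ (1 / 2 : ℝ) * (1 + w ^ 2) ^ (-(1 / 2) : ℝ) := by
          gcongr
          · rw [← Real.sqrt_eq_rpow]; exact Real.abs_le_sqrt (by linarith)
          · nlinarith
          · linarith
      _ = 1 := by rw [← Real.rpow_add (by positivity)]; norm_num
  have h2 : |2 * w * (θ / 2) * (1 + w ^ 2) ^ (θ / 2 - 1)|
      = θ * (|w| * (1 + w ^ 2) ^ (θ / 2 - 1)) := by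
    rw [abs_mul, abs_mul, abs_mul, abs_of_nonneg (show 0 ≤ θ / 2 by linarith), abs_two,
      abs_of_nonneg (show 0 ≤ (1 + w ^ 2) ^ (θ / 2 - 1) by positivity)]
    ring
  rw [h2]
  have : 0 ≤ |w| * (1 + w ^ 2) ^ (θ / 2 - 1) := by positivity
  nlinarith

/-- A `C¹` contraction which translates the half-lines outside `(-H, H)` towards the origin. -/
noncomputable def soften (H w : ℝ) : ℝ := ∫ s in (0 : ℝ)..w, min 1 (|s| / H)

theorem hasDerivAt_soften (H w : ℝ) : HasDerivAt (soften H) (min 1 (|w| / H)) w :=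
  ((by fun_prop : Continuous fun s : ℝ => min 1 (|s| / H)).integral_hasStrictDerivAt 0 w).hasDerivAt

theorem abs_soften_sub_le {H : ℝ} (hH : 0 < H) (p q : ℝ) : |soften H q - soften H p| ≤ |q - p| := by
  have hi := fun a b =>
    (by fun_prop : Continuous fun s : ℝ => min 1 (|s| / H)).intervalIntegrable (μ := volume) a b
  unfold soften
  rw [intervalIntegral.integral_interval_sub_left (hi _ _) (hi _ _)]
  have := intervalIntegral.norm_integral_le_of_norm_le_const (a := p) (b := q) (C := 1)
    (f := fun s : ℝ => min 1 (|s| / H)) fun s _ => by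
      rw [Real.norm_eq_abs, abs_of_nonneg (by positivity)]; exact min_le_left _ _
  simpa using this

theorem soften_neg (H w : ℝ) : soften H (-w) = -soften H w := by
  unfold soften
  rw [intervalIntegral.integral_symm, neg_inj]
  have := intervalIntegral.integral_comp_neg (a := 0) (b := w) (fun s : ℝ => min 1 (|s| / H))
  simp only [abs_neg, neg_zero] at this
  exact this.symm

theorem soften_of_le {H : ℝ} (hH : 0 < H) {w : ℝ} (hw : H ≤ w) : soften H w = w - H / 2 := by
  have hi := fun a b =>
    (by fun_prop : Continuous fun s : ℝ => min 1 (|s| / H)).intervalIntegrable (μ := volume) a b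
  unfold soften
  rw [← intervalIntegral.integral_add_adjacent_intervals (hi 0 H) (hi H w),
    intervalIntegral.integral_congr (g := fun s => s / H) (a := 0) (b := H),
    intervalIntegral.integral_congr (g := fun _ => (1 : ℝ)) (a := H) (b := w)]
  · rw [intervalIntegral.integral_div, integral_id, intervalIntegral.integral_const]
    field_simp
    simp
    ring
  · intro s hs
    rw [uIcc_of_le hw] at hs
    refine min_eq_left ?_
    rw [le_div_iff₀ hH, one_mul, abs_of_nonneg (by linarith [hs.1])]
    exact hs.1
  · intro s hs
    rw [uIcc_of_le hH.le] at hs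
    simp only
    rw [abs_of_nonneg hs.1, min_eq_right]
    rw [div_le_one hH]; exact hs.2

/-- For `w ≥ H` this is `(w - H / 2) ^ 2 = w ^ 2 - w * H + H ^ 2 / 4`. The gap is what raises the
calibrated rate. -/
theorem soften_sq_le {H : ℝ} (hH : 0 < H) {w : ℝ} (hw : H ≤ |w|) :
    soften H w ^ 2 ≤ w ^ 2 - 3 / 4 * H ^ 2 := by
  have h1 : soften H w ^ 2 = soften H |w| ^ 2 := by
    rcases abs_choice w with h | h
    · rw [h]
    · rw [h, soften_neg, neg_sq]
  rw [h1, soften_of_le hH hw, ← sq_abs w]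
  nlinarith

variable {θ α β H : ℝ} {u J : ℝ → ℝ}

/-- The competitor is the optimal staircase through the origin, joined to `u` by two jumps of size
at most `H + |u x - x|` at the endpoints. -/
theorem OptimalStep.exists_energy_upper_bound (h : OptimalStep θ α β H)
    (hu : IsEntireLocalMinimizer θ α β 1 u) (hJ : HasJumps u J) :
    ∃ C, ∀ a b, a < b → energy θ α β u J a b ≤ rate θ α β H * (b - a) + C
      + α * smoothCost θ (u a - a) + α * smoothCost θ (u b - b) := by
  have hH : 0 < 2 * H := by linarith [h.pos]
  obtain ⟨B, hB⟩ := h.potential_bounded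
  refine ⟨2 * B + 2 * (α * jumpCost θ H), fun a b hab => ?_⟩
  have h1 := hu.energy_le h.nonneg h.lt_one.le h.pos_cost h.pos_fidelity hJ
    (hasJumps_steps hH 0) hab (energy_steps hH 0 hab.le θ α β).1
  rw [h.energy_steps_eq 0 hab.le] at h1
  have h2 : ∀ x, jumpCost θ (steps (2 * H) 0 x - u x)
      ≤ jumpCost θ H + smoothCost θ (u x - x) := by
    intro x
    have h3 := jumpCost_add_le h.nonneg h.lt_one.le (steps (2 * H) 0 x - x) (-(u x - x))
    rw [jumpCost_neg, show steps (2 * H) 0 x - x + -(u x - x) = steps (2 * H) 0 x - u x by ring]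
      at h3
    have h4 := jumpCost_mono h.nonneg (y := steps (2 * H) 0 x - x) (z := H) (by
      rw [abs_of_pos h.pos]; linarith [abs_steps_sub_le hH 0 x])
    linarith [jumpCost_le_smoothCost h.nonneg (u x - x)]
  have h5 := mul_le_mul_of_nonneg_left (h2 a) h.pos_cost.le
  have h6 := mul_le_mul_of_nonneg_left (h2 b) h.pos_cost.le
  rw [← neg_sub (u b), jumpCost_neg] at h6
  have h7 := (abs_le.1 (hB (steps (2 * H) 0 a - a))).2
  have h8 := (abs_le.1 (hB (steps (2 * H) 0 b - b))).1
  linarith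

/-- A minimizer cannot stay far from the identity on long intervals. -/
theorem OptimalStep.exists_length_bound_of_large (h : OptimalStep θ α β H)
    (hu : IsEntireLocalMinimizer θ α β 1 u) (hJ : HasJumps u J) :
    ∃ L C, ∀ a b, a < b → (∀ x ∈ Icc a b, L ≤ |u x - x|) →
      b - a ≤ C + 2 * α * smoothCost θ (u a - a) ∧ b - a ≤ C + 2 * α * smoothCost θ (u b - b) := by
  have hα := h.pos_cost
  have hβ := h.pos_fidelity
  have hr := h.rate_pos
  obtain ⟨C, hC⟩ := h.exists_energy_upper_bound hu hJ
  -- Above this threshold the fidelity term pays for rate `rate + 1` and for the slope of `±α *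
  -- smoothCost`, which is at most `α`.
  refine ⟨√((rate θ α β H + 1 + α) / β), C, fun a b hab hL => ?_⟩
  have hsq : ∀ x ∈ Icc a b, rate θ α β H + 1 + α ≤ β * (u x - x) ^ 2 := by
    intro x hx
    have h1 := pow_le_pow_left₀ (Real.sqrt_nonneg _) (hL x hx) 2
    rw [Real.sq_sqrt (by positivity), sq_abs, div_le_iff₀ hβ] at h1
    linarith
  have hf := hu.finiteCost hα hJ a b
  have hE := hC a b hab
  have hcont : Continuous fun w : ℝ => 2 * w * (θ / 2) * (1 + w ^ 2) ^ (θ / 2 - 1) := by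
    have : Continuous fun w : ℝ => (1 + w ^ 2) ^ (θ / 2 - 1) :=
      Continuous.rpow_const (by fun_prop) fun w => Or.inl (by positivity)
    fun_prop
  have hdle : ∀ w, |α * (2 * w * (θ / 2) * (1 + w ^ 2) ^ (θ / 2 - 1))| ≤ α := fun w => by
    rw [abs_mul, abs_of_pos hα]
    exact mul_le_of_le_one_right hα.le (abs_deriv_smoothCost_le h.nonneg h.lt_one.le w)
  -- Each sign cancels the boundary term of the upper bound at one endpoint, so either endpoint
  -- alone controls the length.
  have hplus := hJ.le_energy (β := β) (r := rate θ α β H + 1) hα.le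
    (fun w => (hasDerivAt_smoothCost θ w).const_mul α) (hcont.const_mul α)
    (fun p q => by
      rw [← mul_sub]
      exact mul_le_mul_of_nonneg_left (smoothCost_sub_le h.nonneg h.lt_one.le p q) hα.le)
    hab.le hf fun x hx => by
      linarith [hsq x hx, (abs_le.1 (hdle (u x - x))).2]
  have hminus := hJ.le_energy (β := β) (r := rate θ α β H + 1) hα.le
    (fun w => ((hasDerivAt_smoothCost θ w).const_mul α).fun_neg) (hcont.const_mul α).neg
    (fun p q => by
      rw [← jumpCost_neg, neg_sub]
      have := mul_le_mul_of_nonneg_left (smoothCost_sub_le h.nonneg h.lt_one.le q p) hα.le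
      linarith)
    hab.le hf fun x hx => by
      linarith [hsq x hx, (abs_le.1 (hdle (u x - x))).1]
  constructor <;> linarith

/-- Calibrating with `potential ∘ soften` keeps the drop bound, as `soften` is a contraction. Where
`H ≤ |u x - x|` it gains `3 / 4 * β * H ^ 2` in the rate, contradicting the upper bound on long
intervals with controlled endpoints. -/
theorem OptimalStep.exists_length_bound (h : OptimalStep θ α β H)
    (hu : IsEntireLocalMinimizer θ α β 1 u) (hJ : HasJumps u J) :
    ∃ C, ∀ a b, a < b → (∀ x ∈ Icc a b, H ≤ |u x - x|) →
      3 / 4 * β * H ^ 2 * (b - a)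
        ≤ C + α * smoothCost θ (u a - a) + α * smoothCost θ (u b - b) := by
  have hα := h.pos_cost
  obtain ⟨C, hC⟩ := h.exists_energy_upper_bound hu hJ
  obtain ⟨B, hB⟩ := h.potential_bounded
  refine ⟨C + 2 * B, fun a b hab hH => ?_⟩
  have hE := hC a b hab
  have hsc : Continuous (soften H) :=
    continuous_iff_continuousAt.2 fun x => (hasDerivAt_soften H x).continuousAt
  have hlow := hJ.le_energy (β := β) (r := rate θ α β H + 3 / 4 * β * H ^ 2) hα.le
    (fun w => (hasDerivAt_potential θ α β H (soften H w)).comp w (hasDerivAt_soften H w))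
    (((continuous_slope θ α β H).comp hsc).mul (by fun_prop))
    (fun p q => (h.potential_drop _ _).trans (mul_le_mul_of_nonneg_left
      (jumpCost_mono h.nonneg (abs_soften_sub_le h.pos p q)) hα.le))
    hab.le (hu.finiteCost hα hJ a b) fun x hx => by
      have h1 : min 1 (|u x - x| / H) = 1 :=
        min_eq_left (by rw [le_div_iff₀ h.pos, one_mul]; exact hH x hx)
      rw [h1, mul_one]
      have h2 := slope_le θ α β H (soften H (u x - x))
      have h3 := mul_le_mul_of_nonneg_left (soften_sq_le h.pos (hH x hx)) h.pos_fidelity.le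
      linarith
  simp only [Function.comp] at hlow
  have h1 := (abs_le.1 (hB (soften H (u a - a)))).1
  have h2 := (abs_le.1 (hB (soften H (u b - b)))).2
  linarith

/-- Two stages. The bound through the left endpoint alone yields points arbitrarily far right with
`|u b - b| < L`. With such a `b`, both boundary terms are controlled and `exists_length_bound` fails
on `[T, b]`; `X` is chosen for that. -/
theorem OptimalStep.exists_ge_abs_lt (h : OptimalStep θ α β H)
    (hu : IsEntireLocalMinimizer θ α β 1 u) (hJ : HasJumps u J) (T : ℝ) :
    ∃ b, T ≤ b ∧ |u b - b| < H := by
  by_contra! hcon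
  have hα := h.pos_cost
  obtain ⟨L, C, hL⟩ := h.exists_length_bound_of_large hu hJ
  obtain ⟨C', hC'⟩ := h.exists_length_bound hu hJ
  have hc : 0 < 3 / 4 * β * H ^ 2 := by have := h.pos; have := h.pos_fidelity; positivity
  set X := |C' + α * smoothCost θ (u T - T) + α * smoothCost θ L| / (3 / 4 * β * H ^ 2) with hX
  have hX0 : 0 ≤ X := by positivity
  have hex : ∃ b, T + X + 1 ≤ b ∧ |u b - b| < L := by
    by_contra! hcon'
    set S := T + X + 1
    set Y := |C + 2 * α * smoothCost θ (u S - S)|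
    have := (hL S (S + Y + 1) (by linarith [abs_nonneg (C + 2 * α * smoothCost θ (u S - S))])
      fun x hx => hcon' x hx.1).1
    linarith [le_abs_self (C + 2 * α * smoothCost θ (u S - S))]
  obtain ⟨b, hb, hbL⟩ := hex
  have h1 := hC' T b (by linarith) fun x hx => hcon x hx.1
  have h2 := mul_le_mul_of_nonneg_left (smoothCost_mono h.nonneg
    (hbL.le.trans (le_abs_self L))) hα.le
  have h3 : 3 / 4 * β * H ^ 2 * X = |C' + α * smoothCost θ (u T - T) + α * smoothCost θ L| := by
    rw [hX, mul_comm, div_mul_cancel₀ _ hc.ne']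
  have h4 := le_abs_self (C' + α * smoothCost θ (u T - T) + α * smoothCost θ L)
  nlinarith

/-- Mirror image, using the bound through the right endpoint. -/
theorem OptimalStep.exists_le_abs_lt (h : OptimalStep θ α β H)
    (hu : IsEntireLocalMinimizer θ α β 1 u) (hJ : HasJumps u J) (T : ℝ) :
    ∃ a, a ≤ T ∧ |u a - a| < H := by
  by_contra! hcon
  have hα := h.pos_cost
  obtain ⟨L, C, hL⟩ := h.exists_length_bound_of_large hu hJ
  obtain ⟨C', hC'⟩ := h.exists_length_bound hu hJ
  have hc : 0 < 3 / 4 * β * H ^ 2 := by have := h.pos; have := h.pos_fidelity; positivity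
  set X := |C' + α * smoothCost θ (u T - T) + α * smoothCost θ L| / (3 / 4 * β * H ^ 2) with hX
  have hX0 : 0 ≤ X := by positivity
  have hex : ∃ a, a ≤ T - X - 1 ∧ |u a - a| < L := by
    by_contra! hcon'
    set S := T - X - 1
    set Y := |C + 2 * α * smoothCost θ (u S - S)|
    have := (hL (S - Y - 1) S (by linarith [abs_nonneg (C + 2 * α * smoothCost θ (u S - S))])
      fun x hx => hcon' x hx.2).2
    linarith [le_abs_self (C + 2 * α * smoothCost θ (u S - S))]
  obtain ⟨a, ha, haL⟩ := hex
  have h1 := hC' a T (by linarith) fun x hx => hcon x hx.2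
  have h2 := mul_le_mul_of_nonneg_left (smoothCost_mono h.nonneg
    (haL.le.trans (le_abs_self L))) hα.le
  have h3 : 3 / 4 * β * H ^ 2 * X = |C' + α * smoothCost θ (u T - T) + α * smoothCost θ L| := by
    rw [hX, mul_comm, div_mul_cancel₀ _ hc.ne']
  have h4 := le_abs_self (C' + α * smoothCost θ (u T - T) + α * smoothCost θ L)
  nlinarith

end JumpFunctional

/-! ### Rigidity: equality in the calibration forces the staircase. -/

namespace JumpFunctional

variable {θ α β H : ℝ} {u J : ℝ → ℝ}

/-- Between two points close to the identity, a minimizer does not cost more than a staircase. -/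
theorem OptimalStep.energy_le_of_abs_lt (h : OptimalStep θ α β H)
    (hu : IsEntireLocalMinimizer θ α β 1 u) (hJ : HasJumps u J) {a b : ℝ} (hab : a < b)
    (ha : |u a - a| < H) (hb : |u b - b| < H) {N : ℕ} {d : ℝ} (hd : 2 * H ≤ d)
    (hN : u b - u a = N * d) :
    energy θ α β u J a b ≤ rate θ α β H * (b - a) + potential θ α β H (u a - a)
      - potential θ α β H (u b - b) + N * stepExcess θ α β H d := by
  have hH := h.pos
  have hd0 : 0 < d := by linarith
  have ha' := abs_lt.1 ha
  have hb' := abs_lt.1 hb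
  -- As `H ≤ d / 2`, the staircase through `(u a, u a)` meets `u` at both ends, and no corrective
  -- jumps are needed.
  have hsa : steps d (u a) a = u a := by
    have := steps_eq hd0 (c := u a) (x := a) (n := 0) (by push_cast; linarith)
      (by push_cast; linarith)
    simpa using this
  have hsb : steps d (u a) b = u b := by
    have := steps_eq hd0 (c := u a) (x := b) (n := N) (by push_cast; linarith)
      (by push_cast; linarith)
    rw [this]; push_cast; linarith
  obtain ⟨hf, N', hN', hE⟩ := energy_steps hd0 (u a) hab.le θ α β
  have h1 := hu.energy_le h.nonneg h.lt_one.le h.pos_cost h.pos_fidelity hJ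
    (hasJumps_steps hd0 (u a)) hab hf
  rw [hsa, hsb, hN] at hN'
  have hNN : (N' : ℝ) = N := (mul_right_cancel₀ hd0.ne' hN').symm
  rw [hE, hsa, hsb, sub_self, sub_self, jumpCost_zero, hNN] at h1
  rw [h.potential_eq (ha.le.trans h.le_cutoff), h.potential_eq (hb.le.trans h.le_cutoff), stepExcess]
  linear_combination h1 - rate θ α β H * hN

/-- Minimizers attain equality in the calibration. -/
theorem OptimalStep.energy_eq (h : OptimalStep θ α β H)
    (hu : IsEntireLocalMinimizer θ α β 1 u) (hJ : HasJumps u J) {x y : ℝ} (hxy : x ≤ y) :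
    energy θ α β u J x y = rate θ α β H * (y - x) + potential θ α β H (u x - x)
      - potential θ α β H (u y - y) := by
  have hH := h.pos
  refine le_antisymm (le_of_forall_pos_le_add fun ε hε => ?_)
    (h.le_energy hJ hxy (hu.finiteCost h.pos_cost hJ _ _))
  -- Near `2 * H` the excess is at most `ε / (2 * H) * |d - 2 * H|`; `b` is then taken so far that
  -- `N > 2 * H / δ`.
  have ho := h.hasDerivAt_stepExcess.isLittleO.def (c := ε / (2 * H)) (by positivity)
  obtain ⟨δ, hδ, hball⟩ := Metric.eventually_nhds_iff.1 ho
  obtain ⟨a, hax, ha⟩ := h.exists_le_abs_lt hu hJ x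
  obtain ⟨b, hby, hb⟩ := h.exists_ge_abs_lt hu hJ
    (max y (a + 2 * H + 2 * H * (2 * H / δ + 2)))
  have hyb : y ≤ b := (le_max_left _ _).trans hby
  have hab' : a + 2 * H + 2 * H * (2 * H / δ + 2) ≤ b := (le_max_right _ _).trans hby
  have hq : 0 < 2 * H / δ := by positivity
  have hab : a < b := by nlinarith
  have hX : 2 * H / δ + 2 ≤ (u b - u a) / (2 * H) := by
    rw [le_div_iff₀ (by positivity)]
    linarith [(abs_lt.1 ha).2, (abs_lt.1 hb).1]
  set N := ⌊(u b - u a) / (2 * H)⌋₊ with hN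
  have hN1 : (N : ℝ) ≤ (u b - u a) / (2 * H) := Nat.floor_le (by linarith)
  have hN2 : (u b - u a) / (2 * H) < N + 1 := Nat.lt_floor_add_one _
  have hN0 : (0 : ℝ) < N := by linarith
  have hNδ : 2 * H / δ < N := by linarith
  rw [le_div_iff₀ (by positivity)] at hN1
  rw [div_lt_iff₀ (by positivity)] at hN2
  -- Rounding the number of steps down gives `d ≥ 2 * H` and total stretch `N * (d - 2 * H) ≤ 2 *
  -- H`.
  set d := (u b - u a) / N with hd
  have hNd : u b - u a = N * d := by rw [hd]; field_simp
  have hd1 : 2 * H ≤ d := by rw [hd, le_div_iff₀ hN0]; linarith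
  have hd2 : N * (d - 2 * H) ≤ 2 * H := by rw [mul_sub, ← hNd]; linarith
  have hd3 : d - 2 * H < δ := by
    have h1 : 2 * H < N * δ := (div_lt_iff₀ hδ).1 hNδ
    exact lt_of_mul_lt_mul_left (hd2.trans_lt h1) hN0.le
  have hsmall : N * stepExcess θ α β H d ≤ ε := by
    have h1 := hball (y := d) (by rw [Real.dist_eq, abs_of_nonneg (by linarith)]; exact hd3)
    rw [h.stepExcess_self, sub_zero, smul_zero, sub_zero, Real.norm_eq_abs, Real.norm_eq_abs,
      abs_of_nonneg (show 0 ≤ d - 2 * H by linarith)] at h1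
    calc N * stepExcess θ α β H d ≤ N * (ε / (2 * H) * (d - 2 * H)) := by
          gcongr; exact (le_abs_self _).trans h1
      _ = ε / (2 * H) * (N * (d - 2 * H)) := by ring
      _ ≤ ε / (2 * H) * (2 * H) := by gcongr
      _ = ε := by field_simp
  have hE := h.energy_le_of_abs_lt hu hJ hab ha hb hd1 hNd
  have hfc := fun a b => hu.finiteCost h.pos_cost hJ a b
  rw [energy_add hJ hax (hxy.trans hyb) (hfc a b), energy_add hJ hxy hyb (hfc x b)] at hE
  -- The lower bounds on `(a, x]` and `(y, b]` leave the upper bound on `(x, y]`, up to `ε`.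
  have h1 := h.le_energy hJ hax (hfc a x)
  have h2 := h.le_energy hJ hyb (hfc y b)
  linarith

/-- Beyond the cutoff the slope is zero while `β * w ^ 2 - rate` is positive. By right-continuity
the calibration would be strict on some `(x, y]`, against `energy_eq`. -/
theorem OptimalStep.abs_le_cutoff (h : OptimalStep θ α β H)
    (hu : IsEntireLocalMinimizer θ α β 1 u) (hJ : HasJumps u J) (x : ℝ) :
    |u x - x| ≤ cutoff θ α β H := by
  by_contra! hx
  have ht : Tendsto (fun z => |u z - z|) (𝓝[>] x) (𝓝 |u x - x|) :=
    ((hJ.tendsto_right x).sub (tendsto_id.mono_left nhdsWithin_le_nhds)).abs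
  obtain ⟨y, hxy, hy⟩ := mem_nhdsGT_iff_exists_Ioc_subset.1 (ht.eventually (lt_mem_nhds hx))
  have hxy : x < y := hxy
  have hf := hu.finiteCost h.pos_cost hJ x y
  have h1 := hJ.calibration h.pos_cost.le (hasDerivAt_potential θ α β H)
    (continuous_slope θ α β H) h.potential_drop hxy.le hf
  have h2 : ∫ z in x..y, slope θ α β H (u z - z) = 0 := by
    rw [intervalIntegral.integral_of_le hxy.le, setIntegral_congr_fun measurableSet_Ioc
      (g := fun _ => (0 : ℝ)) fun z hz => h.slope_eq_zero (le_of_lt (hy hz)), integral_zero]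
  have h3 : 0 < ∫ z in x..y, (β * (u z - z) ^ 2 - rate θ α β H) := by
    refine intervalIntegral.intervalIntegral_pos_of_pos_on
      (hJ.integrableOn_comp (f := fun w => β * w ^ 2 - rate θ α β H) (by fun_prop) x y) ?_ hxy
    intro z hz
    have hc : 0 ≤ cutoff θ α β H := Real.sqrt_nonneg _
    have h4 : cutoff θ α β H < |u z - z| := hy (Ioo_subset_Ioc_self hz)
    have h5 := pow_lt_pow_left₀ h4 hc two_ne_zero
    rw [sq_abs] at h5
    rw [← h.cutoff_sq, ← mul_sub]
    exact mul_pos h.pos_fidelity (by linarith)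
  rw [intervalIntegral.integral_sub
    (hJ.integrableOn_comp (f := fun w => β * w ^ 2) (by fun_prop) x y) (by simp),
    intervalIntegral.integral_const_mul, intervalIntegral.integral_const, smul_eq_mul] at h3
  have h6 := h.energy_eq hu hJ hxy.le
  rw [energy] at h6
  linarith

/-- All the jumps of a minimizer go from `-H` to `H` relative to the identity. -/
theorem OptimalStep.jump_eq (h : OptimalStep θ α β H)
    (hu : IsEntireLocalMinimizer θ α β 1 u) (hJ : HasJumps u J) {t : ℝ} (ht : J t ≠ 0) :
    J t = 2 * H ∧ u t - t = H := by
  have hl : Tendsto (fun z => u z - z) (𝓝[<] t) (𝓝 (u t - J t - t)) :=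
    (hJ.tendsto_left t).sub (tendsto_id.mono_left nhdsWithin_le_nhds)
  have hp : |u t - J t - t| ≤ cutoff θ α β H :=
    le_of_tendsto hl.abs (Eventually.of_forall fun z => h.abs_le_cutoff hu hJ z)
  -- Equality on `(z, t]` with `z` increasing to `t` isolates the single jump at `t`.
  have hle : ∀ z ∈ Iio t, α * jumpCost θ (J t) ≤ rate θ α β H * (t - z)
      + potential θ α β H (u z - z) - potential θ α β H (u t - t) := by
    intro z hz
    have hz : z < t := hz
    rw [← h.energy_eq hu hJ hz.le, energy]
    have h1 : jumpCost θ (J t) ≤ totalCost θ J z t := by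
      have := (hu.finiteCost h.pos_cost hJ z t).le_tsum t
        fun _ _ => indicator_jumpCost_nonneg θ J _ _
      rwa [indicator_of_mem (right_mem_Ioc.2 hz)] at this
    have h2 : 0 ≤ ∫ x in z..t, (u x - x) ^ 2 :=
      intervalIntegral.integral_nonneg hz.le fun x _ => sq_nonneg _
    have h3 := mul_le_mul_of_nonneg_left h1 h.pos_cost.le
    have h4 := mul_nonneg h.pos_fidelity.le h2
    linarith
  have hlim : Tendsto (fun z => rate θ α β H * (t - z) + potential θ α β H (u z - z)
      - potential θ α β H (u t - t)) (𝓝[<] t) (𝓝 (rate θ α β H * (t - t)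
      + potential θ α β H (u t - J t - t) - potential θ α β H (u t - t))) := by
    refine ((((tendsto_id.mono_left nhdsWithin_le_nhds).const_sub t).const_mul _).add
      (((hasDerivAt_potential θ α β H _).continuousAt.tendsto).comp hl)).sub_const _
  have hcost := ge_of_tendsto hlim (mem_of_superset self_mem_nhdsWithin hle)
  rw [sub_self, mul_zero, zero_add] at hcost
  have := h.eq_of_cost_le_potential_sub (p := u t - J t - t) (q := u t - t)
    (fun he => ht (by linarith)) hp (h.abs_le_cutoff hu hJ t)
    (by rwa [show u t - t - (u t - J t - t) = J t by ring])
  exact ⟨by linarith [this.1, this.2], this.2⟩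

/-- The entire local minimizers are optimal staircases. -/
theorem OptimalStep.eq_steps (h : OptimalStep θ α β H)
    (hu : IsEntireLocalMinimizer θ α β 1 u) :
    (-H < u 0 ∧ u 0 ≤ H) ∧ ∀ x, u x = steps (2 * H) (u 0) x := by
  have hH := h.pos
  obtain ⟨J, hJ⟩ : ∃ J, HasJumps u J := ⟨_, hu.1.hasJumps⟩
  have hjump := fun t => h.jump_eq hu hJ (t := t)
  -- Summable jumps all equal to `2 * H` are locally finite.
  have hfin : ∀ a b, ∃ F : Finset ℝ, ∀ t, t ∈ F ↔ t ∈ Ioc a b ∧ J t ≠ 0 := by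
    intro a b
    have h1 := (hJ.summable a b).tendsto_cofinite_zero
    have h2 : ∀ᶠ t in cofinite, (Ioc a b).indicator J t < 2 * H :=
      h1.eventually (gt_mem_nhds (by linarith))
    have h3 : {t | t ∈ Ioc a b ∧ J t ≠ 0}.Finite := by
      refine Set.Finite.subset (Filter.eventually_cofinite.1 h2) fun t ht => ?_
      have : ¬ (Ioc a b).indicator J t < 2 * H := by
        rw [indicator_of_mem ht.1, (hjump t ht.2).1]; exact lt_irrefl _
      exact this
    exact ⟨h3.toFinset, fun t => by simp⟩
  have hcard : ∀ a b, a ≤ b → ∃ n : ℕ, u b - u a = n * (2 * H) := by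
    intro a b hab
    obtain ⟨F, hF⟩ := hfin a b
    refine ⟨F.card, ?_⟩
    rw [hJ.sub_eq a b hab]
    exact (hasSum_indicator_card_mul (fun t ht => ((hF t).1 ht).1)
      (fun t ht h0 => (hF t).2 ⟨ht, h0⟩) fun t ht => (hjump t ((hF t).1 ht).2).1).tsum_eq
  have hconst : ∀ a b, a ≤ b → (∀ t ∈ Ioc a b, J t = 0) → u b = u a := by
    intro a b hab h0
    have := hJ.sub_eq a b hab
    rw [indicator_congr (g := fun _ => (0 : ℝ)) h0] at this
    simp at this
    linarith
  -- Below `-H`, `u x - x` keeps decreasing until the next jump, which must start from exactly `-H`;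
  -- so it could never return to `(-H, H)`.
  have hge : ∀ x, -H ≤ u x - x := by
    intro x
    by_contra! hx
    obtain ⟨b, hxb, hb⟩ := h.exists_ge_abs_lt hu hJ x
    obtain ⟨F, hF⟩ := hfin x b
    rcases F.eq_empty_or_nonempty with he | hne
    · have := hconst x b hxb fun t ht => by_contra fun h' => by
        have := (hF t).2 ⟨ht, h'⟩
        simp [he] at this
      linarith [(abs_lt.1 hb).1]
    · have hm := (hF _).1 (F.min'_mem hne)
      set t := F.min' hne
      have hut : u t - u x = J t := by
        rw [hJ.sub_eq x t hm.1.1.le, tsum_eq_single t, indicator_of_mem (right_mem_Ioc.2 hm.1.1)]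
        intro y hy
        by_cases hy' : y ∈ Ioc x t
        · rw [indicator_of_mem hy']
          by_contra h'
          exact hy (le_antisymm hy'.2 (F.min'_le y ((hF y).2 ⟨⟨hy'.1, hy'.2.trans hm.1.2⟩, h'⟩)))
        · rw [indicator_of_notMem hy']
      have := hjump t hm.2
      linarith [hm.1.1, this.1, this.2]
  -- The last jump before `x` ended at `H`, and `u x - x` has decreased since.
  have hle : ∀ x, u x - x ≤ H := by
    intro x
    by_contra! hx
    obtain ⟨a, hax, ha⟩ := h.exists_le_abs_lt hu hJ x
    obtain ⟨F, hF⟩ := hfin a x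
    rcases F.eq_empty_or_nonempty with he | hne
    · have := hconst a x hax fun t ht => by_contra fun h' => by
        have := (hF t).2 ⟨ht, h'⟩
        simp [he] at this
      linarith [(abs_lt.1 ha).2]
    · have hm := (hF _).1 (F.max'_mem hne)
      set t := F.max' hne
      have hut := hconst t x hm.1.2 fun y hy => by_contra fun h' =>
        absurd (F.le_max' y ((hF y).2 ⟨⟨hm.1.1.trans hy.1, hy.2⟩, h'⟩)) (not_le.2 hy.1)
      linarith [hm.1.2, (hjump t hm.2).2]
  -- At the value `-H`, right-continuity and increments in `2 * H * ℕ` keep `u` constant just to the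
  -- right, pushing `u x - x` below `-H`.
  have hgt : ∀ x, -H < u x - x := by
    intro x
    refine lt_of_le_of_ne (hge x) fun heq => ?_
    have hev := (hJ.tendsto_right x).eventually (gt_mem_nhds (show u x < u x + 2 * H by linarith))
    obtain ⟨y, hy, hxy⟩ := (hev.and self_mem_nhdsWithin).exists
    have hxy : x < y := hxy
    obtain ⟨n, hn⟩ := hcard x y hxy.le
    have hn0 : n = 0 := by
      by_contra h'
      have : (1 : ℝ) ≤ n := by exact_mod_cast Nat.one_le_iff_ne_zero.2 h'
      nlinarith
    rw [hn0] at hn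
    push_cast at hn
    linarith [hge y]
  refine ⟨⟨by simpa using hgt 0, by simpa using hle 0⟩, fun x => ?_⟩
  -- `u x` is known modulo `2 * H` and lies in a half-open window of that length, hence is
  -- determined.
  have hint : ∃ n : ℤ, u x = u 0 + 2 * H * n := by
    rcases le_total 0 x with h0 | h0
    · obtain ⟨n, hn⟩ := hcard 0 x h0
      exact ⟨n, by push_cast; linarith⟩
    · obtain ⟨n, hn⟩ := hcard x 0 h0
      exact ⟨-n, by push_cast; linarith⟩
  obtain ⟨n, hn⟩ := hint
  have h1 := hgt x
  have h2 := hle x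
  rw [steps_eq (by linarith) (n := n) (by linarith) (by linarith), hn]

end JumpFunctional

/-! ### Scaling to slope one, and the conclusion. -/

namespace JumpFunctional

/-- The jump term is homogeneous of degree `θ` and the fidelity term of degree two. -/
theorem HasJumps.jf_const_mul {u J : ℝ → ℝ} (h : HasJumps u J) {c : ℝ} (hc : c ≠ 0)
    {θ α β : ℝ} (hα : 0 ≤ α) (hβ : 0 ≤ β) (M : ℝ) (Ω : Set ℝ) :
    JF θ α β (c * M) Ω (fun x => c * u x) = JF θ (α * |c| ^ θ) (β * c ^ 2) M Ω u := by
  rw [h.jf_eq, (h.const_mul c).jf_eq, ENNReal.ofReal_mul hα, ENNReal.ofReal_mul hβ, mul_assoc,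
    mul_assoc]
  congr 2
  · rw [← ENNReal.tsum_mul_left]
    refine tsum_congr fun t => ?_
    by_cases ht : t ∈ Ω
    · rw [indicator_of_mem ht, indicator_of_mem ht, jumpCost_const_mul hc,
        ENNReal.ofReal_mul (by positivity)]
    · rw [indicator_of_notMem ht, indicator_of_notMem ht, mul_zero]
  · rw [← lintegral_const_mul' _ _ ENNReal.ofReal_ne_top]
    refine lintegral_congr fun x => ?_
    rw [← ENNReal.ofReal_mul (sq_nonneg c)]
    congr 1; ring

theorem IsEntireLocalMinimizer.const_mul {u : ℝ → ℝ} {c θ α β M : ℝ} (hc : c ≠ 0)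
    (hα : 0 ≤ α) (hβ : 0 ≤ β)
    (hu : IsEntireLocalMinimizer θ (α * |c| ^ θ) (β * c ^ 2) M u) :
    IsEntireLocalMinimizer θ α β (c * M) (fun x => c * u x) := by
  obtain ⟨h1, h2, h3⟩ := hu
  have hJ := h1.hasJumps
  refine ⟨(hJ.const_mul c).pjloc, fun Ω hΩ hb => ?_, ?_⟩
  · rw [hJ.jf_const_mul hc hα hβ]
    exact h2 Ω hΩ hb
  · rintro Ω hΩ v hv ⟨K, hK, hKΩ, hveq⟩
    have hvJ := hv.hasJumps.const_mul c⁻¹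
    have hvv : v = fun x => c * (c⁻¹ * v x) := by
      ext x; rw [mul_inv_cancel_left₀ hc]
    rw [hvv, hJ.jf_const_mul hc hα hβ, hvJ.jf_const_mul hc hα hβ]
    exact h3 Ω hΩ _ hvJ.pjloc ⟨K, hK, hKΩ, fun x hx => by
      rw [hveq x hx, inv_mul_cancel_left₀ hc]⟩

theorem isEntireLocalMinimizer_iff_normalized {θ α β M : ℝ} (hα : 0 ≤ α) (hβ : 0 ≤ β)
    (hM : M ≠ 0) (u : ℝ → ℝ) :
    IsEntireLocalMinimizer θ α β M u ↔
      IsEntireLocalMinimizer θ (α * |M| ^ θ) (β * M ^ 2) 1 (fun x => M⁻¹ * u x) := by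
  constructor
  · intro hu
    have h1 : α * |M| ^ θ * |M⁻¹| ^ θ = α := by
      rw [mul_assoc, ← Real.mul_rpow (abs_nonneg _) (abs_nonneg _), ← abs_mul, mul_inv_cancel₀ hM,
        abs_one, Real.one_rpow, mul_one]
    have h2 : β * M ^ 2 * M⁻¹ ^ 2 = β := by field_simp
    have := IsEntireLocalMinimizer.const_mul (α := α * |M| ^ θ) (β := β * M ^ 2) (M := M)
      (θ := θ) (u := u) (inv_ne_zero hM) (by positivity) (by positivity) (by rwa [h1, h2])
    rwa [inv_mul_cancel₀ hM] at this
  · intro hu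
    have := IsEntireLocalMinimizer.const_mul hM hα hβ hu
    rw [mul_one] at this
    convert this using 2 with x
    rw [mul_inv_cancel_left₀ hM]

/-- Raising the formula for `H` to the power `3 - θ` gives the balance for the rescaled
coefficients, once the powers of `2 * |M|` are regrouped. -/
theorem optimalStep_of_eq {θ α β M H : ℝ} (hθ : 0 ≤ θ) (hθ' : θ < 1) (hα : 0 < α) (hβ : 0 < β)
    (hM : M ≠ 0)
    (hH : H = (3 * (1 - θ) * α / ((2 * |M|) ^ (2 - θ) * β)) ^ (1 / (3 - θ))) :
    OptimalStep θ (α * |M| ^ θ) (β * M ^ 2) H := by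
  have hM' : 0 < |M| := abs_pos.2 hM
  have h1 : 0 < 1 - θ := by linarith
  have hX : 0 < 3 * (1 - θ) * α / ((2 * |M|) ^ (2 - θ) * β) := by positivity
  have hH0 : 0 < H := hH ▸ Real.rpow_pos_of_pos hX _
  refine ⟨hθ, hθ', by positivity, by positivity, hH0, ?_⟩
  have h2 : H ^ (3 - θ) * ((2 * |M|) ^ (2 - θ) * β) = 3 * (1 - θ) * α := by
    rw [hH, ← Real.rpow_mul hX.le, one_div_mul_cancel (by linarith), Real.rpow_one]
    field_simp
  have h3 : H ^ 3 = H ^ (3 - θ) * H ^ θ := by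
    rw [← Real.rpow_add hH0, sub_add_cancel]; norm_cast
  have h4 : 4 * M ^ 2 = (2 * |M|) ^ (2 - θ) * (2 * |M|) ^ θ := by
    rw [← Real.rpow_add (by positivity), sub_add_cancel]
    norm_cast
    rw [mul_pow, sq_abs]; norm_num
  have h5 : |M| ^ θ * (2 * H) ^ θ = (2 * |M|) ^ θ * H ^ θ := by
    rw [← Real.mul_rpow hM'.le (by positivity), ← Real.mul_rpow (by positivity) hH0.le]
    congr 1; ring
  calc (1 - θ) * (α * |M| ^ θ * (2 * H) ^ θ)
      = (1 - θ) * α * (|M| ^ θ * (2 * H) ^ θ) := by ring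
    _ = 4 / 3 * (β * M ^ 2) * H ^ 3 := by
      rw [h5, h3]
      linear_combination (-((2 * |M|) ^ θ * H ^ θ) / 3) * h2
        - (β * H ^ (3 - θ) * H ^ θ / 3) * h4

theorem staircase_translate_eq {H : ℝ} (hH : H ≠ 0) (M τ x : ℝ) :
    staircase H (M * H) (x - H * τ) + M * H * τ = M * steps (2 * H) (H * τ) x := by
  have : ((x - H * τ) / H + 1) / 2 = (x - H * τ) / (2 * H) + 1 / 2 := by
    field_simp
  rw [staircase, basicStaircase, this, steps]; ring

end JumpFunctional

theorem theorem2p1 (θ α β M : ℝ) (hθ : 0 ≤ θ) (hθ' : θ < 1) (hα : 0 < α) (hβ : 0 < β)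
    (hM : M ≠ 0) (H V : ℝ)
    (hH : H = (3 * (1 - θ) * α / ((2 * |M|) ^ (2 - θ) * β)) ^ (1 / (3 - θ)))
    (hV : V = M * H) :
    {u : ℝ → ℝ | JumpFunctional.IsEntireLocalMinimizer θ α β M u} =
      {v : ℝ → ℝ | JumpFunctional.IsObliqueTranslation H V v} := by
  have h := JumpFunctional.optimalStep_of_eq hθ hθ' hα hβ hM hH
  have hH0 := h.pos
  ext u
  change JumpFunctional.IsEntireLocalMinimizer θ α β M u ↔ ∃ τ ∈ Icc (-1 : ℝ) 1, ∀ x, _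
  rw [JumpFunctional.isEntireLocalMinimizer_iff_normalized hα.le hβ.le hM, hV]
  constructor
  · intro hu
    obtain ⟨⟨h1, h2⟩, h3⟩ := h.eq_steps hu
    -- The normalized staircase passes through `(H * τ, H * τ)`, so `H * τ` is its value at zero;
    -- that value lies in `(-H, H]`.
    refine ⟨M⁻¹ * u 0 / H, ⟨?_, ?_⟩, fun x => ?_⟩
    · rw [le_div_iff₀ hH0]; linarith
    · rw [div_le_iff₀ hH0]; linarith
    · rw [JumpFunctional.staircase_translate_eq hH0.ne', mul_div_cancel₀ _ hH0.ne', ← h3 x,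
        mul_inv_cancel_left₀ hM]
  · rintro ⟨τ, -, hτ⟩
    have : (fun x => M⁻¹ * u x) = JumpFunctional.steps (2 * H) (H * τ) := by
      ext x
      rw [hτ x, JumpFunctional.staircase_translate_eq hH0.ne', inv_mul_cancel_left₀ hM]
    rw [this]
    exact h.isEntireLocalMinimizer_steps (H * τ)
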